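/- **Setting.** Let $\mu=(M_{\mathbb Q},W_\bullet,\widetilde M)$ be a triple: $M_{\mathbb Q}$ is a finite-dimensional rational vector space, $W_\bullet$ is a finite increasing filtration on it, and $\widetilde M=\bigoplus_n\widetilde M_n$, where $\widetilde M_n$ is a Hodge structure of weight $n$ on $Gr^W_nM_{\mathbb Q}$. A mixed Hodge structure is *associated to* $\mu$ if it lives on $M_{\mathbb Q}$, has weight filtration $W_\bullet$, and has $Gr^W=\widetilde M$. For a commutative $\mathbb C$-algebra $R$ let $T(\mu)(R)$ be the set of $R$-linear isomorphisms $\alpha:\widetilde M_{\mathbb C}\otimes R\to M_{\mathbb C}\otimes R$ that preserve the weight filtration and induce the identity on $Gr^W$; let $F^0U(\mu)(R)$ be the group of $R$-linear automorphisms of $\widetilde M_{\mathbb C}\otimes R$ that preserve the weight and Hodge filtrations and induce the identity on $Gr^W$; and let $S(\mu)=T(\mu)/F^0U(\mu)$, where $F^0U(\mu)$ acts by precomposition. The class of $\alpha$ is denoted by $[\alpha]$. A point $s=[\alpha]\in S(\mu)(\mathbb C)$ is identified with the mixed Hodge structure associated to $\mu$ with Hodge filtration $F_s^\bullet=\alpha(F^\bullet\widetilde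 M_{\mathbb C})$. Fix $p\in\mathbb Z$ and let $\mu_p=(W_pM_{\mathbb Q},W_\bullet,W_p\widetilde M)$ and $\mu_{>p}=(M_{\mathbb Q}/W_pM_{\mathbb Q},W_\bullet,\widetilde M/W_p\widetilde M)$. Let $\Theta_p:S(\mu)\to S(\mu_p)\times S(\mu_{>p})$ be the morphism $[\alpha]\mapsto([\alpha_p],[\alpha_{>p}])$, where $\alpha_p$ and $\alpha_{>p}$ are obtained from $\alpha$ by restriction and by passing to the quotient. Let $x\in S(\mu_p)(\mathbb C)$ and $y\in S(\mu_{>p})(\mathbb C)$, let $S(\mu)_{(x,y)}$ be the fiber of $\Theta_p$ above $(x,y)$, and let $F^0_{x,y}\mathrm{Hom}$ be the space of linear maps $f:M_{\mathbb C}/W_pM_{\mathbb C}\to W_pM_{\mathbb C}$ with $f(F_y^k)\subset F_x^k$ for all $k$ (that is, $F^0\underline{Hom}((M/W_pM)_y,(W_pM)_x)$). For a vector space, or the set of sections of a surjective linear map, the superscript $a$ denotes the associated $\mathbb C$-scheme; in particular $(F^0_{x,y}\mathrm{Hom})^a$ has as $R$-points the $R$-linear maps compatible with the filtrations obtained from $F_y$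 and $F_x$ by extension of scalars to $R$. **Statement.** (a) There is a canonical isomorphism $$Sec(M_{\mathbb C}\to M_{\mathbb C}/W_pM_{\mathbb C})^a\,/\,(F^0_{x,y}\mathrm{Hom})^a\ \longrightarrow\ S(\mu)_{(x,y)}.$$ For all representatives $\alpha\in T(\mu_p)(\mathbb C)$ of $x$ and $\beta\in T(\mu_{>p})(\mathbb C)$ of $y$, and every section $\psi$ over a commutative $\mathbb C$-algebra $R$, it sends the class of $\psi$ to $[\alpha+\psi\beta]$, formed with respect to the canonical decomposition $\widetilde M_{\mathbb C}=W_p\widetilde M_{\mathbb C}\oplus\widetilde M_{\mathbb C}/W_p\widetilde M_{\mathbb C}$. (b) For a section $\psi$ of $M_{\mathbb C}\to M_{\mathbb C}/W_pM_{\mathbb C}$, the image of $\psi$ under this isomorphism is the mixed Hodge structure associated to $\mu$ with Hodge filtration $$F^kM_{\mathbb C}=F_x^kW_pM_{\mathbb C}+\psi\bigl(F_y^k(M_{\mathbb C}/W_pM_{\mathbb C})\bigr)\qquad(k\in\mathbb Z).$$ (c) The fiber $S(\mu)_{(x,y)}$ is an affine space over $\mathbb C$, i.e. it is isomorphic to $\mathbb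 A^d_{\mathbb C}$ for some $d\ge 0$. If $W_pM_{\mathbb Q}$ and $M_{\mathbb Q}/W_pM_{\mathbb Q}$ are both nonzero, then $d\ge 1$. -/

import Mathlib

open scoped TensorProduct DirectSum
open CategoryTheory

universe u v w

namespace MHS

/-! ## Filtrations and Hodge structures -/

/-- A finite (exhaustive and separated) increasing filtration on a rational vector space. -/
@[ext]
structure WeightFiltration (M : Type u) [AddCommGroup M] [Module ℚ M] where
  W : ℤ → Submodule ℚ M
  W_mono : Monotone W
  exists_W_bot : ∃ n, W n = ⊥
  exists_W_top : ∃ n, W n = ⊤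

/-- A finite (exhaustive and separated) decreasing filtration on a complex vector space. -/
@[ext]
structure HodgeFiltration (V : Type u) [AddCommGroup V] [Module ℂ V] where
  F : ℤ → Submodule ℂ V
  F_anti : Antitone F
  exists_F_top : ∃ k, F k = ⊤
  exists_F_bot : ∃ k, F k = ⊥

/-- Complex conjugation on the complexification of a rational vector space. -/
noncomputable def conj (H : Type u) [AddCommGroup H] [Module ℚ H] :
    (ℂ ⊗[ℚ] H) →ₛₗ[starRingEnd ℂ] (ℂ ⊗[ℚ] H) where
  toFun := LinearMap.rTensor H (AddMonoidHom.toRatLinearMap (starRingEnd ℂ).toAddMonoidHom)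
  map_add' := map_add _
  map_smul' := by
    intro c z
    induction z with
    | zero => simp
    | add x y hx hy => rw [smul_add, map_add, map_add, smul_add, hx, hy]
    | tmul a h => simp [TensorProduct.smul_tmul']

/-- A (pure, rational) Hodge structure of weight `n` on a rational vector space `H`: a finite
decreasing filtration on `H_ℂ` such that `H_ℂ = F^k ⊕ conj (F^{n+1-k})` for all `k`. As conjugation
is an involution, `conj (F^{n+1-k})` is the preimage of `F^{n+1-k}` under conjugation. -/
@[ext]
structure HodgeStructure (n : ℤ) (H : Type u) [AddCommGroup H] [Module ℚ H]
    extends HodgeFiltration (ℂ ⊗[ℚ] H) where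
  isCompl : ∀ k, IsCompl (F k) ((F (n + 1 - k)).comap (conj H))

namespace WeightFiltration

variable {M : Type u} [AddCommGroup M] [Module ℚ M] (𝓦 : WeightFiltration M)

/-- `Gr^W_n M = W_n M / W_{n-1} M`. -/
def Gr (n : ℤ) : Type u := ↥(𝓦.W n) ⧸ (𝓦.W (n - 1)).submoduleOf (𝓦.W n)

instance (n : ℤ) : AddCommGroup (𝓦.Gr n) :=
  inferInstanceAs (AddCommGroup (↥(𝓦.W n) ⧸ (𝓦.W (n - 1)).submoduleOf (𝓦.W n)))

instance (n : ℤ) : Module ℚ (𝓦.Gr n) :=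
  inferInstanceAs (Module ℚ (↥(𝓦.W n) ⧸ (𝓦.W (n - 1)).submoduleOf (𝓦.W n)))

/-- The projection `W_n M → Gr^W_n M`. -/
def toGr (n : ℤ) : ↥(𝓦.W n) →ₗ[ℚ] 𝓦.Gr n :=
  Submodule.mkQ ((𝓦.W (n - 1)).submoduleOf (𝓦.W n))

/-- The total graded space `Gr^W M = ⨁ n, Gr^W_n M`. -/
def Tot : Type u := ⨁ n, 𝓦.Gr n

noncomputable instance : AddCommGroup 𝓦.Tot := inferInstanceAs (AddCommGroup (⨁ n, 𝓦.Gr n))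

noncomputable instance : Module ℚ 𝓦.Tot := inferInstanceAs (Module ℚ (⨁ n, 𝓦.Gr n))

/-- The inclusion of the component `Gr^W_n M` in `Gr^W M`. -/
noncomputable def ι (n : ℤ) : 𝓦.Gr n →ₗ[ℚ] 𝓦.Tot := DirectSum.lof ℚ ℤ (fun n => 𝓦.Gr n) n

/-- The weight filtration `W_n Gr^W M = ⨁_{m ≤ n} Gr^W_m M`. -/
noncomputable def totW (n : ℤ) : Submodule ℚ 𝓦.Tot := ⨆ m, ⨆ _ : m ≤ n, LinearMap.range (𝓦.ι m)

/-- The filtration induced on `(Gr^W_n M)_ℂ` by a filtration `F` on `M_ℂ`: the image of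
`F ∩ W_n M_ℂ` under `W_n M_ℂ → (Gr^W_n M)_ℂ`. -/
noncomputable def inducedF (F : ℤ → Submodule ℂ (ℂ ⊗[ℚ] M)) (n k : ℤ) : Submodule ℂ (ℂ ⊗[ℚ] 𝓦.Gr n) :=
  ((F k).comap ((𝓦.W n).subtype.baseChange ℂ)).map ((𝓦.toGr n).baseChange ℂ)

/-- The filtration induced on `W_p M`. -/
def sub (p : ℤ) : WeightFiltration ↥(𝓦.W p) where
  W n := (𝓦.W n).comap (𝓦.W p).subtype
  W_mono _ _ h := Submodule.comap_mono (𝓦.W_mono h)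
  exists_W_bot := by
    obtain ⟨n, hn⟩ := 𝓦.exists_W_bot
    exact ⟨n, by rw [hn]; simp⟩
  exists_W_top := by
    obtain ⟨n, hn⟩ := 𝓦.exists_W_top
    exact ⟨n, by rw [hn]; simp⟩

/-- The filtration induced on `M / W_p M`. -/
def quot (p : ℤ) : WeightFiltration (M ⧸ 𝓦.W p) where
  W n := (𝓦.W n).map (𝓦.W p).mkQ
  W_mono _ _ h := Submodule.map_mono (𝓦.W_mono h)
  exists_W_bot := by
    obtain ⟨n, hn⟩ := 𝓦.exists_W_bot
    exact ⟨n, by rw [hn]; simp⟩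
  exists_W_top := by
    obtain ⟨n, hn⟩ := 𝓦.exists_W_top
    exact ⟨n, by rw [hn]; simp⟩

variable {𝓦} {N : Type v} [AddCommGroup N] [Module ℚ N] {𝓥 : WeightFiltration N}

/-- The map `Gr^W_n M → Gr^W_n N` induced by a filtered map `g : M → N`. -/
def grMap (g : M →ₗ[ℚ] N) (hg : ∀ n, ∀ m ∈ 𝓦.W n, g m ∈ 𝓥.W n) (n : ℤ) : 𝓦.Gr n →ₗ[ℚ] 𝓥.Gr n :=
  Submodule.mapQ ((𝓦.W (n - 1)).submoduleOf (𝓦.W n)) ((𝓥.W (n - 1)).submoduleOf (𝓥.W n))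
    (g.restrict (hg n)) (fun x hx => hg (n - 1) x.1 hx)

variable (𝓦)

/-- `Gr^W_n (W_p M) → Gr^W_n M`. -/
def grIncl (p n : ℤ) : (𝓦.sub p).Gr n →ₗ[ℚ] 𝓦.Gr n :=
  grMap (𝓦 := 𝓦.sub p) (𝓥 := 𝓦) (𝓦.W p).subtype (fun _ _ h => h) n

/-- `Gr^W_n M → Gr^W_n (M / W_p M)`. -/
def grProj (p n : ℤ) : 𝓦.Gr n →ₗ[ℚ] (𝓦.quot p).Gr n :=
  grMap (𝓦 := 𝓦) (𝓥 := 𝓦.quot p) (𝓦.W p).mkQ (fun _ _ h => Submodule.mem_map_of_mem h) n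

/-- `Gr^W (W_p M) → Gr^W M`. -/
noncomputable def totIncl (p : ℤ) : (𝓦.sub p).Tot →ₗ[ℚ] 𝓦.Tot :=
  DirectSum.lmap (fun n => 𝓦.grIncl p n)

/-- `Gr^W M → Gr^W (M / W_p M)`. -/
noncomputable def totProj (p : ℤ) : 𝓦.Tot →ₗ[ℚ] (𝓦.quot p).Tot :=
  DirectSum.lmap (fun n => 𝓦.grProj p n)

theorem grIncl_bijective {p n : ℤ} (h : n ≤ p) : Function.Bijective (𝓦.grIncl p n) := by
  constructor
  · rw [← LinearMap.ker_eq_bot, LinearMap.ker_eq_bot']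
    intro m
    induction m using Submodule.Quotient.induction_on with
    | _ x =>
      intro hx
      have hx' : (Submodule.Quotient.mk ⟨x.1.1, x.2⟩ : 𝓦.Gr n) = 0 := hx
      have hx'' := (Submodule.Quotient.mk_eq_zero _).1 hx'
      exact (Submodule.Quotient.mk_eq_zero _).2 hx''
  · intro m
    induction m using Submodule.Quotient.induction_on with
    | _ x => exact ⟨Submodule.Quotient.mk ⟨⟨x.1, 𝓦.W_mono h x.2⟩, x.2⟩, rfl⟩

theorem subsingleton_gr_sub {p n : ℤ} (h : p < n) : Subsingleton ((𝓦.sub p).Gr n) := by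
  refine Submodule.Quotient.subsingleton_iff.2 (eq_top_iff.2 ?_)
  intro x _
  exact 𝓦.W_mono (show p ≤ n - 1 by lia) x.1.2

theorem grProj_bijective {p n : ℤ} (h : p < n) : Function.Bijective (𝓦.grProj p n) := by
  constructor
  · rw [← LinearMap.ker_eq_bot, LinearMap.ker_eq_bot']
    intro m
    induction m using Submodule.Quotient.induction_on with
    | _ x =>
      intro hx
      refine (Submodule.Quotient.mk_eq_zero _).2 ?_
      obtain ⟨y, hy, hyx⟩ := (Submodule.Quotient.mk_eq_zero _).1 hx
      have h1 : x.1 - y ∈ 𝓦.W p := (Submodule.Quotient.eq _).1 hyx.symm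
      have h2 := 𝓦.W_mono (show p ≤ n - 1 by lia) h1
      have h3 := Submodule.add_mem _ h2 hy
      rw [sub_add_cancel] at h3
      exact h3
  · intro m
    induction m using Submodule.Quotient.induction_on with
    | _ x =>
      obtain ⟨x, y, hy, rfl⟩ := x
      exact ⟨Submodule.Quotient.mk ⟨y, hy⟩, rfl⟩

theorem subsingleton_gr_quot {p n : ℤ} (h : n ≤ p) : Subsingleton ((𝓦.quot p).Gr n) := by
  refine Submodule.Quotient.subsingleton_iff.2 (eq_top_iff.2 ?_)
  rintro ⟨x, y, hy, rfl⟩ _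
  have : (𝓦.W p).mkQ y = 0 := (Submodule.Quotient.mk_eq_zero _).2 (𝓦.W_mono h hy)
  refine (Submodule.mem_comap).2 ?_
  change (𝓦.W p).mkQ y ∈ (𝓦.quot p).W (n - 1)
  rw [this]
  exact Submodule.zero_mem _

end WeightFiltration

theorem conj_baseChange {H : Type u} [AddCommGroup H] [Module ℚ H] {H' : Type v} [AddCommGroup H']
    [Module ℚ H'] (g : H →ₗ[ℚ] H') (z : ℂ ⊗[ℚ] H) :
    conj H' (g.baseChange ℂ z) = g.baseChange ℂ (conj H z) := by
  induction z with
  | zero => simp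
  | add x y hx hy => simp only [map_add, hx, hy]
  | tmul a h => simp [conj]

theorem isCompl_comap_conj {H : Type u} [AddCommGroup H] [Module ℚ H] {H' : Type v}
    [AddCommGroup H'] [Module ℚ H'] (g : H' →ₗ[ℚ] H) (hg : Function.Bijective g)
    {A B : Submodule ℂ (ℂ ⊗[ℚ] H)} (h : IsCompl A (B.comap (conj H))) :
    IsCompl (A.comap (g.baseChange ℂ)) ((B.comap (g.baseChange ℂ)).comap (conj H')) := by
  have h1 : (B.comap (g.baseChange ℂ)).comap (conj H') =
      (B.comap (conj H)).comap (g.baseChange ℂ) := by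
    ext z
    simp only [Submodule.mem_comap, conj_baseChange]
  rw [h1]
  obtain ⟨e, rfl⟩ : ∃ e : H' ≃ₗ[ℚ] H, g = e.toLinearMap := ⟨LinearEquiv.ofBijective g hg, rfl⟩
  exact (Submodule.orderIsoMapComap (e.baseChange ℚ ℂ H' H)).symm.isCompl h

theorem map_eq_comap_of_inverse {H : Type u} [AddCommGroup H] [Module ℚ H] {H' : Type v}
    [AddCommGroup H'] [Module ℚ H'] (e : H ≃ₗ[ℚ] H') (A : Submodule ℂ (ℂ ⊗[ℚ] H)) :
    A.map (e.toLinearMap.baseChange ℂ) = A.comap (e.symm.toLinearMap.baseChange ℂ) :=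
  Submodule.map_equiv_eq_comap_symm (e.baseChange ℚ ℂ H H') A

theorem isCompl_map_conj {H : Type u} [AddCommGroup H] [Module ℚ H] {H' : Type v}
    [AddCommGroup H'] [Module ℚ H'] (g : H →ₗ[ℚ] H') (hg : Function.Bijective g)
    {A B : Submodule ℂ (ℂ ⊗[ℚ] H)} (h : IsCompl A (B.comap (conj H))) :
    IsCompl (A.map (g.baseChange ℂ)) ((B.map (g.baseChange ℂ)).comap (conj H')) := by
  obtain ⟨e, rfl⟩ : ∃ e : H ≃ₗ[ℚ] H', g = e.toLinearMap := ⟨LinearEquiv.ofBijective g hg, rfl⟩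
  rw [map_eq_comap_of_inverse, map_eq_comap_of_inverse]
  exact isCompl_comap_conj _ e.symm.bijective h

theorem baseChange_bijective {H : Type u} [AddCommGroup H] [Module ℚ H] {H' : Type v}
    [AddCommGroup H'] [Module ℚ H'] (g : H →ₗ[ℚ] H') (hg : Function.Bijective g) :
    Function.Bijective (g.baseChange ℂ) := by
  obtain ⟨e, rfl⟩ : ∃ e : H ≃ₗ[ℚ] H', g = e.toLinearMap := ⟨LinearEquiv.ofBijective g hg, rfl⟩
  exact (e.baseChange ℚ ℂ H H').bijective

/-! ## Triples and mixed Hodge structures -/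

/-- A triple `(M, W, M̃)`: a finite increasing filtration `W` on the rational vector space `M`, and a
Hodge structure of weight `n` on `Gr^W_n M` for every `n`. -/
@[ext]
structure Triple (M : Type u) [AddCommGroup M] [Module ℚ M] extends WeightFiltration M where
  hodge : ∀ n, HodgeStructure n (toWeightFiltration.Gr n)

/-- A (rational) mixed Hodge structure on `M`: a weight filtration on `M`, and a Hodge filtration on
`M_ℂ` that induces a Hodge structure of weight `n` on `Gr^W_n M` for every `n`. -/
@[ext]
structure MixedHodgeStructure (M : Type u) [AddCommGroup M] [Module ℚ M]
    extends WeightFiltration M, HodgeFiltration (ℂ ⊗[ℚ] M) where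
  isCompl : ∀ n k, IsCompl (toWeightFiltration.inducedF F n k)
    ((toWeightFiltration.inducedF F n (n + 1 - k)).comap (conj (toWeightFiltration.Gr n)))

section

variable {M : Type u} [AddCommGroup M] [Module ℚ M]

/-- The triple `(M, W, Gr^W N)` of a mixed Hodge structure `N` on `M`. -/
noncomputable def MixedHodgeStructure.toTriple (N : MixedHodgeStructure M) : Triple M where
  toWeightFiltration := N.toWeightFiltration
  hodge n :=
    { F := N.inducedF N.F n
      F_anti := fun _ _ h => Submodule.map_mono (Submodule.comap_mono (N.F_anti h))
      exists_F_top := by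
        obtain ⟨k, hk⟩ := N.exists_F_top
        refine ⟨k, ?_⟩
        rw [WeightFiltration.inducedF, hk, Submodule.comap_top, Submodule.map_top,
          LinearMap.range_eq_top]
        exact LinearMap.lTensor_surjective _ (Submodule.mkQ_surjective _)
      exists_F_bot := by
        obtain ⟨k, hk⟩ := N.exists_F_bot
        refine ⟨k, ?_⟩
        rw [WeightFiltration.inducedF, hk, Submodule.comap_bot, LinearMap.ker_eq_bot.2]
        · simp
        · exact Module.Flat.lTensor_preserves_injective_linearMap _
            (Submodule.injective_subtype _)
      isCompl := N.isCompl n }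

/-- A mixed Hodge structure `N` on `M` is associated to the triple `μ = (M, W, M̃)` if its weight
filtration is `W` and `Gr^W N = M̃`. -/
def MixedHodgeStructure.IsAssociated (N : MixedHodgeStructure M) (μ : Triple M) : Prop :=
  N.toTriple = μ

namespace Triple

variable (μ : Triple M)

/-- The Hodge filtration `F^k M̃_ℂ = ⨁ n, F^k (M̃_n)_ℂ` of `M̃ = Gr^W M`. -/
noncomputable def totF (k : ℤ) : Submodule ℂ (ℂ ⊗[ℚ] μ.Tot) :=
  ⨆ n, ((μ.hodge n).F k).map ((μ.ι n).baseChange ℂ)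

/-- The triple `μ_p = (W_p M, W, W_p M̃)`. -/
noncomputable abbrev sub (p : ℤ) : Triple ↥(μ.W p) where
  toWeightFiltration := μ.toWeightFiltration.sub p
  hodge n :=
    { F := fun k => ((μ.hodge n).F k).comap ((μ.grIncl p n).baseChange ℂ)
      F_anti := fun _ _ h => Submodule.comap_mono ((μ.hodge n).F_anti h)
      exists_F_top := by
        obtain ⟨k, hk⟩ := (μ.hodge n).exists_F_top
        exact ⟨k, by rw [hk, Submodule.comap_top]⟩
      exists_F_bot := by
        obtain ⟨k, hk⟩ := (μ.hodge n).exists_F_bot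
        refine ⟨k, ?_⟩
        rcases le_or_gt n p with h | h
        · rw [hk, Submodule.comap_bot, LinearMap.ker_eq_bot]
          exact (baseChange_bijective _ (μ.grIncl_bijective h)).injective
        · have := μ.subsingleton_gr_sub h
          exact Subsingleton.elim _ _
      isCompl := by
        intro k
        rcases le_or_gt n p with h | h
        · exact isCompl_comap_conj _ (μ.grIncl_bijective h) ((μ.hodge n).isCompl k)
        · have := μ.subsingleton_gr_sub h
          exact ⟨disjoint_iff.2 (Subsingleton.elim _ _), codisjoint_iff.2 (Subsingleton.elim _ _)⟩ }

/-- The triple `μ_{>p} = (M / W_p M, W, M̃ / W_p M̃)`. -/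
noncomputable abbrev quot (p : ℤ) : Triple (M ⧸ μ.W p) where
  toWeightFiltration := μ.toWeightFiltration.quot p
  hodge n :=
    { F := fun k => ((μ.hodge n).F k).map ((μ.grProj p n).baseChange ℂ)
      F_anti := fun _ _ h => Submodule.map_mono ((μ.hodge n).F_anti h)
      exists_F_top := by
        obtain ⟨k, hk⟩ := (μ.hodge n).exists_F_top
        refine ⟨k, ?_⟩
        rcases le_or_gt n p with h | h
        · have := μ.subsingleton_gr_quot h
          exact Subsingleton.elim _ _
        · rw [hk, Submodule.map_top, LinearMap.range_eq_top]
          exact (baseChange_bijective _ (μ.grProj_bijective h)).surjective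
      exists_F_bot := by
        obtain ⟨k, hk⟩ := (μ.hodge n).exists_F_bot
        exact ⟨k, by rw [hk, Submodule.map_bot]⟩
      isCompl := by
        intro k
        rcases le_or_gt n p with h | h
        · have := μ.subsingleton_gr_quot h
          exact ⟨disjoint_iff.2 (Subsingleton.elim _ _), codisjoint_iff.2 (Subsingleton.elim _ _)⟩
        · exact isCompl_map_conj _ (μ.grProj_bijective h) ((μ.hodge n).isCompl k) }

end Triple

end

/-! ## Extension of scalars -/

section Pts

variable (R : Type w) [CommRing R] [Algebra ℂ R]

/-- `M_ℂ ⊗ R`, for a rational vector space `M` and a `ℂ`-algebra `R`. -/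
abbrev Pts (M : Type u) [AddCommGroup M] [Module ℚ M] : Type max u w := R ⊗[ℂ] (ℂ ⊗[ℚ] M)

/-- The `R`-linear extension `M_ℂ ⊗ R → N_ℂ ⊗ R` of a `ℚ`-linear map `M → N`. -/
noncomputable abbrev ext {M : Type u} [AddCommGroup M] [Module ℚ M] {N : Type v} [AddCommGroup N]
    [Module ℚ N] (g : M →ₗ[ℚ] N) : Pts R M →ₗ[R] Pts R N :=
  (g.baseChange ℂ).baseChange R

/-- The submodule `P_ℂ ⊗ R` of `M_ℂ ⊗ R`, for a rational subspace `P` of `M`. -/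
noncomputable def extSub {M : Type u} [AddCommGroup M] [Module ℚ M] (P : Submodule ℚ M) :
    Submodule R (Pts R M) :=
  (P.baseChange ℂ).baseChange R

variable {R} {R' : Type w} [CommRing R'] [Algebra ℂ R']

/-- The map `V ⊗ R → V ⊗ R'` induced by a homomorphism `R → R'`. -/
noncomputable def chg (f : R →ₐ[ℂ] R') (V : Type u) [AddCommGroup V] [Module ℂ V] :
    R ⊗[ℂ] V →ₗ[ℂ] R' ⊗[ℂ] V :=
  f.toLinearMap.rTensor V

/-- The extension along `f : R → R'` of an `R`-linear map `V ⊗ R → V' ⊗ R` to an `R'`-linear map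
`V ⊗ R' → V' ⊗ R'`. -/
noncomputable def chgMap (f : R →ₐ[ℂ] R') {V : Type u} [AddCommGroup V] [Module ℂ V] {V' : Type v}
    [AddCommGroup V'] [Module ℂ V'] (α : R ⊗[ℂ] V →ₗ[R] R ⊗[ℂ] V') :
    R' ⊗[ℂ] V →ₗ[R'] R' ⊗[ℂ] V' :=
  LinearMap.liftBaseChange R'
    (chg f V' ∘ₗ α.restrictScalars ℂ ∘ₗ TensorProduct.mk ℂ R V 1)

end Pts

section PtsLemmas

variable {R : Type w} [CommRing R] [Algebra ℂ R] {R' : Type w} [CommRing R'] [Algebra ℂ R']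
variable {R'' : Type w} [CommRing R''] [Algebra ℂ R'']

section V
variable {V : Type u} [AddCommGroup V] [Module ℂ V] {V' : Type v} [AddCommGroup V'] [Module ℂ V']
variable {V'' : Type*} [AddCommGroup V''] [Module ℂ V'']

theorem chg_tmul (f : R →ₐ[ℂ] R') (r : R) (v : V) : chg f V (r ⊗ₜ v) = f r ⊗ₜ v := rfl

theorem chg_smul (f : R →ₐ[ℂ] R') (r : R) (z : R ⊗[ℂ] V) : chg f V (r • z) = f r • chg f V z := by
  induction z with
  | zero => simp
  | add x y hx hy => rw [smul_add, map_add, map_add, smul_add, hx, hy]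
  | tmul a h => simp [TensorProduct.smul_tmul', chg_tmul]

theorem chgMap_chg (f : R →ₐ[ℂ] R') (α : R ⊗[ℂ] V →ₗ[R] R ⊗[ℂ] V') (z : R ⊗[ℂ] V) :
    chgMap f α (chg f V z) = chg f V' (α z) := by
  induction z with
  | zero => simp
  | add x y hx hy => simp only [map_add, hx, hy]
  | tmul a h =>
    rw [chg_tmul, chgMap, LinearMap.liftBaseChange_tmul]
    have : a ⊗ₜ[ℂ] h = a • ((1 : R) ⊗ₜ[ℂ] h) := by simp [TensorProduct.smul_tmul']
    rw [this, map_smul, chg_smul]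
    rfl

theorem hom_ext_chg (f : R →ₐ[ℂ] R') {X : Type*} [AddCommGroup X] [Module R' X]
    {φ ψ : R' ⊗[ℂ] V →ₗ[R'] X} (h : ∀ z, φ (chg f V z) = ψ (chg f V z)) : φ = ψ := by
  ext z
  induction z with
  | zero => simp
  | add x y hx hy => simp only [map_add, hx, hy]
  | tmul a v =>
    have h1 : a ⊗ₜ[ℂ] v = a • chg f V ((1 : R) ⊗ₜ[ℂ] v) := by
      simp [TensorProduct.smul_tmul', chg_tmul]
    rw [h1, map_smul, map_smul, h]

theorem chgMap_comp (f : R →ₐ[ℂ] R') (β : R ⊗[ℂ] V' →ₗ[R] R ⊗[ℂ] V'')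
    (α : R ⊗[ℂ] V →ₗ[R] R ⊗[ℂ] V') : chgMap f (β ∘ₗ α) = chgMap f β ∘ₗ chgMap f α :=
  hom_ext_chg f fun z => by simp [chgMap_chg]

theorem chgMap_id (f : R →ₐ[ℂ] R') :
    chgMap f (LinearMap.id : R ⊗[ℂ] V →ₗ[R] R ⊗[ℂ] V) = LinearMap.id :=
  hom_ext_chg f fun z => by simp [chgMap_chg]

theorem chgMap_add (f : R →ₐ[ℂ] R') (α β : R ⊗[ℂ] V →ₗ[R] R ⊗[ℂ] V') :
    chgMap f (α + β) = chgMap f α + chgMap f β :=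
  hom_ext_chg f fun z => by simp [chgMap_chg]

theorem chg_id (z : R ⊗[ℂ] V) : chg (AlgHom.id ℂ R) V z = z := by
  simp [chg]

theorem chg_comp (g : R' →ₐ[ℂ] R'') (f : R →ₐ[ℂ] R') (z : R ⊗[ℂ] V) :
    chg (g.comp f) V z = chg g V (chg f V z) := by
  simp only [chg]
  rw [← LinearMap.comp_apply, ← LinearMap.rTensor_comp]
  rfl

theorem chgMap_id' (α : R ⊗[ℂ] V →ₗ[R] R ⊗[ℂ] V') : chgMap (AlgHom.id ℂ R) α = α :=
  hom_ext_chg (AlgHom.id ℂ R) fun z => by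
    rw [chgMap_chg, chg_id, chg_id]

theorem chgMap_comp' (g : R' →ₐ[ℂ] R'') (f : R →ₐ[ℂ] R') (α : R ⊗[ℂ] V →ₗ[R] R ⊗[ℂ] V') :
    chgMap (g.comp f) α = chgMap g (chgMap f α) :=
  hom_ext_chg (g.comp f) fun z => by
    rw [chgMap_chg, chg_comp, chg_comp, chgMap_chg, chgMap_chg]

theorem chgMap_baseChange (f : R →ₐ[ℂ] R') (g : V →ₗ[ℂ] V') :
    chgMap f (g.baseChange R) = g.baseChange R' := by
  ext v
  simp [chgMap, chg_tmul]

theorem chg_mem_baseChange (f : R →ₐ[ℂ] R') (P : Submodule ℂ V) {z : R ⊗[ℂ] V}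
    (hz : z ∈ P.baseChange R) : chg f V z ∈ P.baseChange R' := by
  obtain ⟨y, rfl⟩ := hz
  rw [← chgMap_chg, chgMap_baseChange]
  exact ⟨_, rfl⟩

/-- To check a linear condition on `P ⊗ R'`, it is enough to check it on the image of `P ⊗ R`. -/
theorem baseChange_induction (f : R →ₐ[ℂ] R') (P : Submodule ℂ V) {X : Type*} [AddCommGroup X]
    [Module R' X] (φ : R' ⊗[ℂ] V →ₗ[R'] X) (Q : Submodule R' X)
    (h : ∀ z ∈ P.baseChange R, φ (chg f V z) ∈ Q) : ∀ z ∈ P.baseChange R', φ z ∈ Q := by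
  rintro _ ⟨y, rfl⟩
  induction y with
  | zero => simp
  | add x y hx hy => rw [map_add, map_add]; exact Q.add_mem hx hy
  | tmul a v =>
    have h1 : a ⊗ₜ[ℂ] v.1 = a • chg f V ((1 : R) ⊗ₜ[ℂ] v.1) := by
      simp [TensorProduct.smul_tmul', chg_tmul]
    rw [LinearMap.baseChange_tmul, Submodule.subtype_apply, h1, map_smul]
    exact Q.smul_mem _ (h _ (Submodule.tmul_mem_baseChange_of_mem _ v.2))

theorem map_baseChange (P : Submodule ℂ V) (g : V →ₗ[ℂ] V') :
    (P.baseChange R).map (g.baseChange R) = (P.map g).baseChange R := by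
  rw [Submodule.baseChange, Submodule.baseChange, ← LinearMap.range_comp,
    ← LinearMap.baseChange_comp]
  have h : g ∘ₗ P.subtype = (P.map g).subtype ∘ₗ (g.submoduleMap P) := rfl
  rw [h, LinearMap.baseChange_comp, LinearMap.range_comp, LinearMap.range_eq_top.2,
    Submodule.map_top]
  exact LinearMap.lTensor_surjective _ (g.submoduleMap_surjective P)

theorem baseChange_mono {P Q : Submodule ℂ V} (h : P ≤ Q) : P.baseChange R ≤ Q.baseChange R := by
  rw [Submodule.baseChange_eq_span, Submodule.baseChange_eq_span]
  exact Submodule.span_mono (Submodule.map_mono h)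

end V

section M
variable {M : Type u} [AddCommGroup M] [Module ℚ M] {N : Type v} [AddCommGroup N] [Module ℚ N]
  {L : Type*} [AddCommGroup L] [Module ℚ L]

theorem ext_comp_apply (g : N →ₗ[ℚ] L) (h : M →ₗ[ℚ] N) (z : Pts R M) :
    ext R (g ∘ₗ h) z = ext R g (ext R h z) := by
  simp only [ext, LinearMap.baseChange_comp, LinearMap.comp_apply]

theorem ext_id_apply (z : Pts R M) : ext R (LinearMap.id : M →ₗ[ℚ] M) z = z := by
  simp only [ext, LinearMap.baseChange_id, LinearMap.id_apply]

theorem ext_injective (g : M →ₗ[ℚ] N) (hg : Function.Injective g) :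
    Function.Injective (ext R g) :=
  Module.Flat.lTensor_preserves_injective_linearMap _
    (Module.Flat.lTensor_preserves_injective_linearMap (M := ℂ) _ hg)

theorem ext_surjective (g : M →ₗ[ℚ] N) (hg : Function.Surjective g) :
    Function.Surjective (ext R g) :=
  LinearMap.lTensor_surjective _ (LinearMap.lTensor_surjective ℂ hg)

theorem map_baseChange_rat (P : Submodule ℚ M) (g : M →ₗ[ℚ] N) :
    (P.baseChange ℂ).map (g.baseChange ℂ) = (P.map g).baseChange ℂ := by
  rw [Submodule.baseChange, Submodule.baseChange, ← LinearMap.range_comp,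
    ← LinearMap.baseChange_comp]
  have h : g ∘ₗ P.subtype = (P.map g).subtype ∘ₗ (g.submoduleMap P) := rfl
  rw [h, LinearMap.baseChange_comp, LinearMap.range_comp, LinearMap.range_eq_top.2,
    Submodule.map_top]
  exact LinearMap.lTensor_surjective _ (g.submoduleMap_surjective P)

theorem map_extSub (P : Submodule ℚ M) (g : M →ₗ[ℚ] N) :
    (extSub R P).map (ext R g) = extSub R (P.map g) := by
  rw [extSub, extSub, map_baseChange, map_baseChange_rat]

theorem extSub_top : extSub R (⊤ : Submodule ℚ M) = ⊤ := by
  simp [extSub]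

theorem extSub_bot : extSub R (⊥ : Submodule ℚ M) = ⊥ := by
  simp [extSub]

theorem range_ext (g : M →ₗ[ℚ] N) : LinearMap.range (ext R g) = extSub R (LinearMap.range g) := by
  rw [LinearMap.range_eq_map, LinearMap.range_eq_map, ← extSub_top, map_extSub]

theorem extSub_eq_range (P : Submodule ℚ M) : extSub R P = LinearMap.range (ext R P.subtype) := by
  rw [range_ext, Submodule.range_subtype]

theorem extSub_mono {P Q : Submodule ℚ M} (h : P ≤ Q) : extSub R P ≤ extSub R Q := by
  refine baseChange_mono ?_
  rw [Submodule.baseChange_eq_span, Submodule.baseChange_eq_span]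
  exact Submodule.span_mono (Submodule.map_mono h)

theorem extSub_sup (P Q : Submodule ℚ M) : extSub R (P ⊔ Q) ≤ extSub R P ⊔ extSub R Q := by
  rw [extSub_eq_range (P ⊔ Q)]
  rintro _ ⟨z, rfl⟩
  have hs : (P ⊔ Q).subtype ∘ₗ
      ((Submodule.inclusion le_sup_left).coprod (Submodule.inclusion (le_sup_right (a := P)))) =
      P.subtype ∘ₗ LinearMap.fst ℚ P Q + Q.subtype ∘ₗ LinearMap.snd ℚ P Q := by
    ext <;> simp
  have hsurj : Function.Surjective ((Submodule.inclusion (le_sup_left (b := Q))).coprod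
      (Submodule.inclusion (le_sup_right (a := P)))) := by
    rintro ⟨x, hx⟩
    obtain ⟨y, hy, z, hz, rfl⟩ := Submodule.mem_sup.1 hx
    exact ⟨(⟨y, hy⟩, ⟨z, hz⟩), rfl⟩
  obtain ⟨y, rfl⟩ := ext_surjective (R := R) _ hsurj z
  rw [← ext_comp_apply, hs]
  simp only [ext, LinearMap.baseChange_add, LinearMap.add_apply]
  refine Submodule.add_mem_sup ?_ ?_
  · rw [extSub_eq_range]
    exact ⟨_, (ext_comp_apply _ _ _).symm⟩
  · rw [extSub_eq_range]
    exact ⟨_, (ext_comp_apply _ _ _).symm⟩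

theorem ext_mem_extSub {P : Submodule ℚ M} {Q : Submodule ℚ N} (g : M →ₗ[ℚ] N)
    (h : ∀ m ∈ P, g m ∈ Q) {z : Pts R M}
    (hz : z ∈ extSub R P) : ext R g z ∈ extSub R Q := by
  have h1 : ext R g z ∈ (extSub R P).map (ext R g) := Submodule.mem_map_of_mem hz
  rw [map_extSub] at h1
  exact extSub_mono (Submodule.map_le_iff_le_comap.2 h) h1

theorem ext_mem_extSub_of_range {Q : Submodule ℚ N} (g : M →ₗ[ℚ] N)
    (h : ∀ m, g m ∈ Q) (z : Pts R M) : ext R g z ∈ extSub R Q :=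
  ext_mem_extSub (P := ⊤) g (fun m _ => h m) (by rw [extSub_top]; trivial)

theorem ext_sub_apply (g h : M →ₗ[ℚ] N) (z : Pts R M) :
    ext R (g - h) z = ext R g z - ext R h z := by
  simp only [ext, sub_eq_add_neg, LinearMap.baseChange_add, LinearMap.add_apply,
    LinearMap.baseChange_neg, LinearMap.neg_apply]

theorem chg_ext (f : R →ₐ[ℂ] R') (g : M →ₗ[ℚ] N) (z : Pts R M) :
    ext R' g (chg f _ z) = chg f _ (ext R g z) := by
  rw [ext, ← chgMap_baseChange f, chgMap_chg]

end M

end PtsLemmas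
/-! ## The graded space of a weight filtration -/

namespace WeightFiltration

variable {M : Type u} [AddCommGroup M] [Module ℚ M] (𝓦 : WeightFiltration M)

theorem range_ι_le {m n : ℤ} (h : m ≤ n) : LinearMap.range (𝓦.ι m) ≤ 𝓦.totW n :=
  le_iSup₂_of_le (f := fun m (_ : m ≤ n) => LinearMap.range (𝓦.ι m)) m h le_rfl

theorem totW_mono : Monotone 𝓦.totW := fun _ _ h =>
  iSup₂_le fun _ hm => 𝓦.range_ι_le (hm.trans h)

theorem totW_le (n : ℤ) : 𝓦.totW n ≤ LinearMap.range (𝓦.ι n) ⊔ 𝓦.totW (n - 1) := by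
  refine iSup₂_le fun m hm => ?_
  rcases eq_or_lt_of_le hm with rfl | h
  · exact le_sup_left
  · exact le_sup_of_le_right (𝓦.range_ι_le (by lia))

theorem tot_induction {p : 𝓦.Tot → Prop} (x : 𝓦.Tot) (h0 : p 0)
    (hι : ∀ n g, p (𝓦.ι n g)) (hadd : ∀ x y, p x → p y → p (x + y)) : p x :=
  DirectSum.induction_on x h0 hι hadd

theorem totW_eq_bot {n : ℤ} (h : 𝓦.W n = ⊥) : 𝓦.totW n = ⊥ := by
  refine (Submodule.eq_bot_iff _).2 fun x hx => ?_
  have : 𝓦.totW n ≤ ⊥ := by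
    refine iSup₂_le fun m hm => ?_
    rintro _ ⟨g, rfl⟩
    induction g using Submodule.Quotient.induction_on with
    | _ g =>
      obtain ⟨g, hg⟩ := g
      have hg' := 𝓦.W_mono hm hg
      rw [h] at hg'
      obtain rfl : g = 0 := hg'
      exact map_zero (𝓦.ι m)
  exact this hx

theorem totW_eq_top {n : ℤ} (h : 𝓦.W n = ⊤) : 𝓦.totW n = ⊤ := by
  refine eq_top_iff.2 fun x _ => ?_
  induction x using tot_induction with
  | h0 => exact Submodule.zero_mem _
  | hadd x y hx hy => exact Submodule.add_mem _ (hx trivial) (hy trivial)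
  | hι m g =>
    rcases le_or_gt m n with hm | hm
    · exact 𝓦.range_ι_le hm ⟨g, rfl⟩
    · have hg : g = 0 := by
        induction g using Submodule.Quotient.induction_on with
        | _ g =>
          refine (Submodule.Quotient.mk_eq_zero _).2 ?_
          refine 𝓦.W_mono (show n ≤ m - 1 by lia) ?_
          rw [h]
          trivial
      rw [hg, map_zero]
      exact Submodule.zero_mem _

theorem totIncl_ι (p n : ℤ) (g : (𝓦.sub p).Gr n) :
    𝓦.totIncl p ((𝓦.sub p).ι n g) = 𝓦.ι n (𝓦.grIncl p n g) :=
  DirectSum.lmap_lof _ _ _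

theorem totProj_ι (p n : ℤ) (g : 𝓦.Gr n) :
    𝓦.totProj p (𝓦.ι n g) = (𝓦.quot p).ι n (𝓦.grProj p n g) :=
  DirectSum.lmap_lof _ _ _

theorem totIncl_mem (p : ℤ) (x : (𝓦.sub p).Tot) : 𝓦.totIncl p x ∈ 𝓦.totW p := by
  induction x using tot_induction with
  | h0 => rw [map_zero]; exact Submodule.zero_mem _
  | hadd x y hx hy => rw [map_add]; exact Submodule.add_mem _ hx hy
  | hι m g =>
    rw [totIncl_ι]
    rcases le_or_gt m p with hm | hm
    · exact 𝓦.range_ι_le hm ⟨_, rfl⟩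
    · have := 𝓦.subsingleton_gr_sub hm
      rw [Subsingleton.elim g 0, map_zero, map_zero]
      exact Submodule.zero_mem _

theorem totIncl_mem_totW (p n : ℤ) (x : (𝓦.sub p).Tot) (hx : x ∈ (𝓦.sub p).totW n) :
    𝓦.totIncl p x ∈ 𝓦.totW n := by
  have : (𝓦.sub p).totW n ≤ (𝓦.totW n).comap (𝓦.totIncl p) := by
    refine iSup₂_le fun m hm => ?_
    rintro _ ⟨g, rfl⟩
    rw [Submodule.mem_comap, totIncl_ι]
    exact 𝓦.range_ι_le hm ⟨_, rfl⟩
  exact this hx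

theorem totProj_surjective (p : ℤ) : Function.Surjective (𝓦.totProj p) := by
  refine (DirectSum.lmap_surjective _).2 fun n => ?_
  rcases le_or_gt n p with h | h
  · have := 𝓦.subsingleton_gr_quot h
    exact fun x => ⟨0, Subsingleton.elim _ _⟩
  · exact (𝓦.grProj_bijective h).surjective

theorem totW_quot_le (p n : ℤ) : (𝓦.quot p).totW n ≤ (𝓦.totW n).map (𝓦.totProj p) := by
  refine iSup₂_le fun m hm => ?_
  rintro _ ⟨g, rfl⟩
  rcases le_or_gt m p with h | h
  · have := 𝓦.subsingleton_gr_quot h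
    rw [Subsingleton.elim g 0, map_zero]
    exact Submodule.zero_mem _
  · obtain ⟨g, rfl⟩ := (𝓦.grProj_bijective h).surjective g
    exact ⟨𝓦.ι m g, 𝓦.range_ι_le hm ⟨g, rfl⟩, 𝓦.totProj_ι p m g⟩

/-- The canonical section of `Gr^W M → Gr^W (M / W_p M)`: on the component of degree `n > p` it is the
inverse of `Gr^W_n M ≅ Gr^W_n (M / W_p M)`, and the components of degree `n ≤ p` are zero. -/
noncomputable def totSec (p : ℤ) : (𝓦.quot p).Tot →ₗ[ℚ] 𝓦.Tot :=
  DirectSum.lmap fun n =>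
    if h : p < n then (LinearEquiv.ofBijective _ (𝓦.grProj_bijective h)).symm.toLinearMap else 0

theorem totSec_sub_mem (p : ℤ) (x : 𝓦.Tot) :
    (𝓦.totSec p ∘ₗ 𝓦.totProj p - LinearMap.id : 𝓦.Tot →ₗ[ℚ] 𝓦.Tot) x ∈ 𝓦.totW p := by
  induction x using tot_induction with
  | h0 => rw [map_zero]; exact Submodule.zero_mem _
  | hadd x y hx hy => rw [map_add]; exact Submodule.add_mem _ hx hy
  | hι n g =>
    rw [LinearMap.sub_apply, LinearMap.comp_apply, totProj_ι, LinearMap.id_apply]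
    have h1 : 𝓦.totSec p ((𝓦.quot p).ι n (𝓦.grProj p n g)) = 𝓦.ι n _ := DirectSum.lmap_lof _ _ _
    rw [h1]
    rcases le_or_gt n p with h | h
    · rw [← map_sub]
      exact 𝓦.range_ι_le h ⟨_, rfl⟩
    · rw [dif_pos h]
      have h2 := (LinearEquiv.ofBijective _ (𝓦.grProj_bijective h)).symm_apply_apply g
      have h3 : (LinearEquiv.ofBijective _ (𝓦.grProj_bijective h)).symm.toLinearMap
        (𝓦.grProj p n g) = g := h2
      rw [h3, sub_self]
      exact Submodule.zero_mem _

/-- A retraction of `Gr^W (W_p M) → Gr^W M`. -/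
noncomputable def totRetr (p : ℤ) : 𝓦.Tot →ₗ[ℚ] (𝓦.sub p).Tot :=
  DirectSum.lmap fun n =>
    if h : n ≤ p then (LinearEquiv.ofBijective _ (𝓦.grIncl_bijective h)).symm.toLinearMap else 0

theorem totRetr_ι (p n : ℤ) (g : (𝓦.sub p).Gr n) :
    𝓦.totRetr p (𝓦.ι n (𝓦.grIncl p n g)) = (𝓦.sub p).ι n g := by
  refine (DirectSum.lmap_lof _ _ _).trans ?_
  rcases le_or_gt n p with h | h
  · rw [dif_pos h]
    exact congrArg _ ((LinearEquiv.ofBijective _ (𝓦.grIncl_bijective h)).symm_apply_apply g)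
  · have := 𝓦.subsingleton_gr_sub h
    exact congrArg _ (Subsingleton.elim _ _)

theorem totRetr_comp (p : ℤ) : 𝓦.totRetr p ∘ₗ 𝓦.totIncl p = LinearMap.id := by
  refine LinearMap.ext fun x => ?_
  induction x using tot_induction with
  | h0 => simp
  | hadd x y hx hy => rw [map_add, hx, hy, map_add]
  | hι m g => rw [LinearMap.comp_apply, totIncl_ι, totRetr_ι, LinearMap.id_apply]

theorem totIncl_injective (p : ℤ) : Function.Injective (𝓦.totIncl p) := fun x y h => by
  have := congrArg (𝓦.totRetr p) h
  rwa [← LinearMap.comp_apply, ← LinearMap.comp_apply, totRetr_comp] at this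

variable {R : Type w} [CommRing R] [Algebra ℂ R]

/-- An element of `W_n (M̃ ⊗ R)` is the sum of the class of an element of `W_n M ⊗ R` and an element
of `W_{n-1} (M̃ ⊗ R)`. -/
theorem exists_of_mem_totW {n : ℤ} {z : Pts R 𝓦.Tot} (hz : z ∈ extSub R (𝓦.totW n)) :
    ∃ u : Pts R (𝓦.W n), ∃ z' ∈ extSub R (𝓦.totW (n - 1)),
      z = ext R (𝓦.ι n ∘ₗ 𝓦.toGr n) u + z' := by
  obtain ⟨a, ha, z', hz', rfl⟩ :=
    Submodule.mem_sup.1 (extSub_sup _ _ (extSub_mono (𝓦.totW_le n) hz))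
  rw [← range_ext] at ha
  obtain ⟨g, rfl⟩ := ha
  obtain ⟨u, rfl⟩ := ext_surjective (R := R) (𝓦.toGr n) (Submodule.mkQ_surjective _) g
  exact ⟨u, z', hz', by rw [ext_comp_apply]⟩

theorem toGr_eq_zero_of_mem {n : ℤ} {u : Pts R (𝓦.W n)}
    (hu : ext R (𝓦.W n).subtype u ∈ extSub R (𝓦.W (n - 1))) : ext R (𝓦.toGr n) u = 0 := by
  rw [extSub_eq_range] at hu
  obtain ⟨y, hy⟩ := hu
  have hle : 𝓦.W (n - 1) ≤ 𝓦.W n := 𝓦.W_mono (by lia)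
  have h1 : (𝓦.W (n - 1)).subtype = (𝓦.W n).subtype ∘ₗ Submodule.inclusion hle := rfl
  rw [h1, ext_comp_apply] at hy
  rw [← ext_injective (R := R) _ (Submodule.injective_subtype _) hy, ← ext_comp_apply]
  have h2 : 𝓦.toGr n ∘ₗ Submodule.inclusion hle = 0 := by
    ext1 x
    exact (Submodule.Quotient.mk_eq_zero _).2 x.2
  rw [h2]
  simp [ext]

/-- A linear map `α : M̃ ⊗ R → M ⊗ R` preserves the weight filtration and induces the identity on
the associated graded. -/
structure InducesGrId (α : Pts R 𝓦.Tot →ₗ[R] Pts R M) : Prop where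
  map_W : ∀ n, ∀ z ∈ extSub R (𝓦.totW n), α z ∈ extSub R (𝓦.W n)
  gr_id : ∀ n (u : Pts R (𝓦.W n)),
    α (ext R (𝓦.ι n ∘ₗ 𝓦.toGr n) u) - ext R (𝓦.W n).subtype u ∈ extSub R (𝓦.W (n - 1))

variable {𝓦}

namespace InducesGrId

variable {α β : Pts R 𝓦.Tot →ₗ[R] Pts R M}

theorem exists_preimage (hα : 𝓦.InducesGrId α) (n : ℤ) :
    ∀ z ∈ extSub R (𝓦.W n), ∃ y ∈ extSub R (𝓦.totW n), α y = z := by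
  obtain ⟨b, hb⟩ := 𝓦.exists_W_bot
  rcases le_total n b with h | h
  · intro z hz
    have hn : 𝓦.W n = ⊥ := eq_bot_iff.2 (hb ▸ 𝓦.W_mono h)
    rw [hn, extSub_bot] at hz
    obtain rfl : z = 0 := hz
    exact ⟨0, Submodule.zero_mem _, map_zero _⟩
  · induction n, h using Int.leInduction with
    | base =>
      intro z hz
      rw [hb, extSub_bot] at hz
      obtain rfl : z = 0 := hz
      exact ⟨0, Submodule.zero_mem _, map_zero _⟩
    | succ n hn ih =>
      intro z hz
      rw [extSub_eq_range] at hz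
      obtain ⟨u, rfl⟩ := hz
      have h1 := extSub_mono (𝓦.W_mono (show n + 1 - 1 ≤ n by lia)) (hα.gr_id (n + 1) u)
      obtain ⟨y, hy, hy'⟩ := ih _ h1
      refine ⟨ext R (𝓦.ι (n + 1) ∘ₗ 𝓦.toGr (n + 1)) u - y, Submodule.sub_mem _ ?_ ?_, ?_⟩
      · exact ext_mem_extSub_of_range (𝓦.ι (n + 1) ∘ₗ 𝓦.toGr (n + 1))
          (fun m => 𝓦.range_ι_le le_rfl ⟨_, rfl⟩) u
      · exact extSub_mono (𝓦.totW_mono (by lia)) hy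
      · rw [map_sub, hy', sub_sub_cancel]

theorem mem_totW_sub_one (hα : 𝓦.InducesGrId α) {n : ℤ} {z : Pts R 𝓦.Tot}
    (hz : z ∈ extSub R (𝓦.totW n)) (h : α z ∈ extSub R (𝓦.W (n - 1))) :
    z ∈ extSub R (𝓦.totW (n - 1)) := by
  obtain ⟨u, z', hz', rfl⟩ := 𝓦.exists_of_mem_totW hz
  have h1 := hα.gr_id n u
  have h2 := hα.map_W _ _ hz'
  have h3 : ext R (𝓦.W n).subtype u ∈ extSub R (𝓦.W (n - 1)) := by
    rw [map_add] at h
    have := Submodule.sub_mem _ (Submodule.sub_mem _ h h2) h1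
    convert this using 1
    abel
  rw [ext_comp_apply, 𝓦.toGr_eq_zero_of_mem h3, map_zero, zero_add]
  exact hz'

theorem bijective (hα : 𝓦.InducesGrId α) : Function.Bijective α := by
  obtain ⟨t, ht⟩ := 𝓦.exists_W_top
  constructor
  · rw [← LinearMap.ker_eq_bot, LinearMap.ker_eq_bot']
    intro z hz
    obtain ⟨b, hb⟩ := 𝓦.exists_W_bot
    have key : ∀ k : ℕ, z ∈ extSub R (𝓦.totW (t - k)) := by
      intro k
      induction k with
      | zero =>
        rw [Nat.cast_zero, sub_zero, 𝓦.totW_eq_top ht, extSub_top]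
        trivial
      | succ k ih =>
        have := hα.mem_totW_sub_one ih (by rw [hz]; exact Submodule.zero_mem _)
        rwa [Nat.cast_succ, ← sub_sub]
    have h1 := extSub_mono (𝓦.totW_mono (show t - (t - b).toNat ≤ b by lia)) (key _)
    rw [𝓦.totW_eq_bot hb, extSub_bot] at h1
    exact h1
  · intro z
    obtain ⟨y, -, hy⟩ := hα.exists_preimage t z (by rw [ht, extSub_top]; trivial)
    exact ⟨y, hy⟩

theorem mem_iff (hα : 𝓦.InducesGrId α) (n : ℤ) (z : Pts R 𝓦.Tot) :
    α z ∈ extSub R (𝓦.W n) ↔ z ∈ extSub R (𝓦.totW n) := by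
  refine ⟨fun h => ?_, hα.map_W n z⟩
  obtain ⟨y, hy, hyz⟩ := hα.exists_preimage n _ h
  rwa [← hα.bijective.injective hyz]

theorem sub_mem (hα : 𝓦.InducesGrId α) (hβ : 𝓦.InducesGrId β) {n : ℤ} {z : Pts R 𝓦.Tot}
    (hz : z ∈ extSub R (𝓦.totW n)) : β z - α z ∈ extSub R (𝓦.W (n - 1)) := by
  obtain ⟨u, z', hz', rfl⟩ := 𝓦.exists_of_mem_totW hz
  have h1 := Submodule.sub_mem _ (hβ.gr_id n u) (hα.gr_id n u)
  have h2 := Submodule.sub_mem _ (hβ.map_W _ _ hz') (hα.map_W _ _ hz')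
  convert Submodule.add_mem _ h1 h2 using 1
  rw [map_add, map_add]
  abel

variable {R' : Type w} [CommRing R'] [Algebra ℂ R']

theorem baseChange (hα : 𝓦.InducesGrId α) (f : R →ₐ[ℂ] R') : 𝓦.InducesGrId (chgMap f α) where
  map_W n := by
    refine baseChange_induction f _ _ _ fun z hz => ?_
    rw [chgMap_chg]
    exact chg_mem_baseChange f _ (hα.map_W n z hz)
  gr_id n u := by
    have := baseChange_induction f (⊤ : Submodule ℂ (ℂ ⊗[ℚ] 𝓦.W n))
      ((chgMap f α) ∘ₗ (ext R' (𝓦.ι n ∘ₗ 𝓦.toGr n) : Pts R' (𝓦.W n) →ₗ[R'] Pts R' 𝓦.Tot) -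
        ext R' (𝓦.W n).subtype)
      (extSub R' (𝓦.W (n - 1))) (fun z _ => ?_) u (by rw [Submodule.baseChange_top]; trivial)
    · simpa using this
    · rw [LinearMap.sub_apply, LinearMap.comp_apply, chg_ext, chgMap_chg, chg_ext, ← map_sub]
      exact chg_mem_baseChange f _ (hα.gr_id n z)

end InducesGrId

end WeightFiltration
/-! ## The spaces `T(μ)`, `U(μ)`, `F⁰U(μ)` and `S(μ)` -/

namespace Triple

variable {M : Type u} [AddCommGroup M] [Module ℚ M] (μ : Triple M)

section Points

variable (R : Type w) [CommRing R] [Algebra ℂ R]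

/-- The `R`-points of `T(μ)`: the `R`-linear isomorphisms `M̃_ℂ ⊗ R → M_ℂ ⊗ R` that preserve the
weight filtration and induce the identity on the associated graded. -/
@[ext]
structure T where
  toEquiv : Pts R μ.Tot ≃ₗ[R] Pts R M
  inducesGrId : μ.InducesGrId toEquiv.toLinearMap

/-- The `R`-points of `U(μ)`: the automorphisms of `M̃_ℂ ⊗ R` that preserve the weight filtration and
induce the identity on the associated graded. -/
def U : Subgroup (Pts R μ.Tot ≃ₗ[R] Pts R μ.Tot) where
  carrier := {u | (∀ n, (extSub R (μ.totW n)).map u.toLinearMap = extSub R (μ.totW n)) ∧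
    ∀ n, ∀ z ∈ extSub R (μ.totW n), u z - z ∈ extSub R (μ.totW (n - 1))}
  mul_mem' := by
    rintro u v ⟨hu, hu'⟩ ⟨hv, hv'⟩
    refine ⟨fun n => ?_, fun n z hz => ?_⟩
    · refine (Submodule.map_comp v.toLinearMap u.toLinearMap _).trans ?_
      rw [hv, hu]
    · have h1 : v z ∈ extSub R (μ.totW n) := by
        rw [← hv n]
        exact Submodule.mem_map_of_mem hz
      have := Submodule.add_mem _ (hu' n _ h1) (hv' n z hz)
      rwa [sub_add_sub_cancel] at this
  one_mem' := by
    refine ⟨fun n => Submodule.map_id _, fun n z _ => ?_⟩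
    rw [LinearEquiv.coe_one, id, sub_self]
    exact Submodule.zero_mem _
  inv_mem' := by
    rintro u ⟨hu, hu'⟩
    have key : ∀ n, ∀ z ∈ extSub R (μ.totW n), u⁻¹ z ∈ extSub R (μ.totW n) := by
      intro n z hz
      rw [← hu n] at hz
      obtain ⟨y, hy, rfl⟩ := hz
      have : u⁻¹ (u y) = y := u.symm_apply_apply y
      exact this.symm ▸ hy
    refine ⟨fun n => le_antisymm ?_ ?_, fun n z hz => ?_⟩
    · rintro _ ⟨z, hz, rfl⟩
      exact key n z hz
    · intro z hz
      refine ⟨u z, ?_, u.symm_apply_apply z⟩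
      have : u z ∈ (extSub R (μ.totW n)).map u.toLinearMap := Submodule.mem_map_of_mem hz
      rwa [hu] at this
    · have h1 := Submodule.neg_mem _ (hu' n _ (key n z hz))
      have h2 : u (u⁻¹ z) = z := u.apply_symm_apply z
      rwa [h2, neg_sub] at h1

/-- The `R`-points of `F⁰U(μ)`: the elements of `U(μ)` that preserve the Hodge filtration. -/
def F0U : Subgroup (Pts R μ.Tot ≃ₗ[R] Pts R μ.Tot) where
  carrier := {u | u ∈ μ.U R ∧
    ∀ k, ((μ.totF k).baseChange R).map u.toLinearMap = (μ.totF k).baseChange R}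
  mul_mem' := by
    rintro u v ⟨hu, hu'⟩ ⟨hv, hv'⟩
    refine ⟨Subgroup.mul_mem _ hu hv, fun k => ?_⟩
    refine (Submodule.map_comp v.toLinearMap u.toLinearMap _).trans ?_
    rw [hv', hu']
  one_mem' := ⟨Subgroup.one_mem _, fun k => Submodule.map_id _⟩
  inv_mem' := by
    rintro u ⟨hu, hu'⟩
    refine ⟨Subgroup.inv_mem _ hu, fun k => ?_⟩
    conv_lhs => rw [← hu' k]
    refine (Submodule.map_comp u.toLinearMap (u⁻¹).toLinearMap _).symm.trans ?_
    have : (u⁻¹).toLinearMap ∘ₗ u.toLinearMap = LinearMap.id :=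
      LinearMap.ext fun z => u.symm_apply_apply z
    rw [this, Submodule.map_id]

/-- The equivalence relation on `T(μ)(R)` given by the right action of `F⁰U(μ)(R)` by
precomposition. -/
def TSetoid : Setoid (μ.T R) where
  r α β := ∃ u ∈ μ.F0U R, ∀ z, β.toEquiv z = α.toEquiv (u z)
  iseqv :=
    { refl := fun α => ⟨1, Subgroup.one_mem _, fun z => rfl⟩
      symm := by
        rintro α β ⟨u, hu, h⟩
        refine ⟨u⁻¹, Subgroup.inv_mem _ hu, fun z => ?_⟩
        rw [h]
        exact congrArg _ (u.apply_symm_apply z).symm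
      trans := by
        rintro α β γ ⟨u, hu, h⟩ ⟨v, hv, h'⟩
        refine ⟨u * v, Subgroup.mul_mem _ hu hv, fun z => ?_⟩
        rw [h', h]
        rfl }

/-- The `R`-points of the quotient `S(μ) = T(μ)/F⁰U(μ)`. Since `F⁰U(μ)` is unipotent over a field of
characteristic zero, all its torsors over affine schemes are trivial, so that the quotient variety
has as set of `R`-points the quotient of `T(μ)(R)` by `F⁰U(μ)(R)`. -/
def SPts : Type max u w := Quotient (μ.TSetoid R)

variable {R}

/-- The class `[α]` in `S(μ)(R)` of `α` in `T(μ)(R)`. -/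
def T.cls {μ : Triple M} (α : μ.T R) : μ.SPts R := Quotient.mk (μ.TSetoid R) α

variable {μ}

theorem T.cls_eq_iff {α β : μ.T R} : α.cls = β.cls ↔ ∀ k,
    ((μ.totF k).baseChange R).map α.toEquiv.toLinearMap =
      ((μ.totF k).baseChange R).map β.toEquiv.toLinearMap := by
  refine Quotient.eq.trans ⟨?_, fun h => ?_⟩
  · rintro ⟨u, hu, h⟩ k
    have h1 : β.toEquiv.toLinearMap = α.toEquiv.toLinearMap ∘ₗ u.toLinearMap := LinearMap.ext h
    rw [h1, Submodule.map_comp, hu.2 k]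
  · refine ⟨β.toEquiv.trans α.toEquiv.symm, ⟨⟨fun n => ?_, fun n z hz => ?_⟩, fun k => ?_⟩,
      fun z => (α.toEquiv.apply_symm_apply _).symm⟩
    · ext z
      constructor
      · rintro ⟨y, hy, rfl⟩
        refine (α.inducesGrId.mem_iff n _).1 ?_
        have : α.toEquiv (α.toEquiv.symm (β.toEquiv y)) ∈ extSub R (μ.W n) := by
          rw [LinearEquiv.apply_symm_apply]
          exact β.inducesGrId.map_W n y hy
        exact this
      · intro hz
        refine ⟨β.toEquiv.symm (α.toEquiv z), (β.inducesGrId.mem_iff n _).1 ?_, ?_⟩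
        · have : β.toEquiv (β.toEquiv.symm (α.toEquiv z)) ∈ extSub R (μ.W n) := by
            rw [LinearEquiv.apply_symm_apply]
            exact α.inducesGrId.map_W n z hz
          exact this
        · change α.toEquiv.symm (β.toEquiv (β.toEquiv.symm (α.toEquiv z))) = z
          rw [LinearEquiv.apply_symm_apply, LinearEquiv.symm_apply_apply]
    · refine (α.inducesGrId.mem_iff (n - 1) _).1 ?_
      have : α.toEquiv (α.toEquiv.symm (β.toEquiv z) - z) ∈ extSub R (μ.W (n - 1)) := by
        rw [map_sub, LinearEquiv.apply_symm_apply]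
        exact α.inducesGrId.sub_mem β.inducesGrId hz
      exact this
    · rw [LinearEquiv.coe_trans, Submodule.map_comp, ← h k, ← Submodule.map_comp]
      have : α.toEquiv.symm.toLinearMap ∘ₗ α.toEquiv.toLinearMap = LinearMap.id :=
        LinearMap.ext fun z => α.toEquiv.symm_apply_apply z
      rw [this, Submodule.map_id]

variable (μ)

/-- The `R`-point of `T(μ)` given by a linear map that preserves the weight filtration and induces
the identity on the associated graded (such a map is bijective). -/
noncomputable def T.ofLinearMap (α : Pts R μ.Tot →ₗ[R] Pts R M) (h : μ.InducesGrId α) : μ.T R where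
  toEquiv := LinearEquiv.ofBijective α h.bijective
  inducesGrId := h

variable {μ} {R' : Type w} [CommRing R'] [Algebra ℂ R']

/-- The map `T(μ)(R) → T(μ)(R')` induced by `R → R'`. -/
noncomputable def T.map (f : R →ₐ[ℂ] R') (α : μ.T R) : μ.T R' :=
  T.ofLinearMap μ (chgMap f α.toEquiv.toLinearMap) (α.inducesGrId.baseChange f)

theorem T.map_toLinearMap (f : R →ₐ[ℂ] R') (α : μ.T R) :
    (α.map f).toEquiv.toLinearMap = chgMap f α.toEquiv.toLinearMap := rfl

theorem T.ext_linearMap {α β : μ.T R} (h : ∀ z, α.toEquiv z = β.toEquiv z) : α = β :=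
  T.ext (LinearEquiv.ext h)

theorem map_chgMap_le {V : Type u} [AddCommGroup V] [Module ℂ V] {V' : Type v} [AddCommGroup V']
    [Module ℂ V'] (f : R →ₐ[ℂ] R') (P : Submodule ℂ V) (α β : R ⊗[ℂ] V →ₗ[R] R ⊗[ℂ] V')
    (h : (P.baseChange R).map α ≤ (P.baseChange R).map β) :
    (P.baseChange R').map (chgMap f α) ≤ (P.baseChange R').map (chgMap f β) := by
  refine Submodule.map_le_iff_le_comap.2 fun z hz => ?_
  refine baseChange_induction f P (chgMap f α) ((P.baseChange R').map (chgMap f β))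
    (fun y hy => ?_) z hz
  obtain ⟨x, hx, hxy⟩ := h (Submodule.mem_map_of_mem hy)
  rw [chgMap_chg, ← hxy, ← chgMap_chg]
  exact Submodule.mem_map_of_mem (chg_mem_baseChange f P hx)

/-- The map `S(μ)(R) → S(μ)(R')` induced by `R → R'`. -/
noncomputable def SPts.map (f : R →ₐ[ℂ] R') : μ.SPts R → μ.SPts R' :=
  Quotient.lift (fun α : μ.T R => (α.map f).cls) fun α β h => by
    have h1 := T.cls_eq_iff.1 (Quotient.sound h : α.cls = β.cls)
    exact T.cls_eq_iff.2 fun k => le_antisymm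
      (map_chgMap_le f _ _ _ (h1 k).le) (map_chgMap_le f _ _ _ (h1 k).ge)

theorem SPts.map_cls (f : R →ₐ[ℂ] R') (α : μ.T R) : SPts.map f α.cls = (α.map f).cls := rfl

end Points

/-- The variety `S(μ)`, given by its functor of points on commutative `ℂ`-algebras (in `Type`, which
includes all finitely generated ones). -/
noncomputable def S : CommAlgCat.{0} ℂ ⥤ Type u where
  obj R := μ.SPts R
  map f := ↾(SPts.map f.hom)
  map_id R := by
    ext s
    induction s using Quotient.inductionOn with
    | _ α =>
      refine congrArg T.cls (T.ext_linearMap fun z => ?_)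
      exact LinearMap.congr_fun (chgMap_id' α.toEquiv.toLinearMap) z
  map_comp f g := by
    ext s
    induction s using Quotient.inductionOn with
    | _ α =>
      refine congrArg T.cls (T.ext_linearMap fun z => ?_)
      exact LinearMap.congr_fun (chgMap_comp' g.hom f.hom α.toEquiv.toLinearMap) z

/-- The Hodge filtration `F_s` on `M_ℂ` at a complex point `s` of `S(μ)`: it is `α (F M̃_ℂ)` for any
representative `α` of `s`. -/
noncomputable def hodgeF (s : μ.SPts ℂ) (k : ℤ) : Submodule ℂ (ℂ ⊗[ℚ] M) :=
  Quotient.lift (fun α : μ.T ℂ => (((μ.totF k).baseChange ℂ).map α.toEquiv.toLinearMap).map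
      (TensorProduct.lid ℂ (ℂ ⊗[ℚ] M)).toLinearMap)
    (fun α β h => by
      have h1 := T.cls_eq_iff.1 (Quotient.sound h : α.cls = β.cls)
      exact congrArg _ (h1 k)) s

/-! ## The map `Θ_p` -/

section Theta

variable {R : Type w} [CommRing R] [Algebra ℂ R] {μ}

theorem exists_restrict (p : ℤ) (α : μ.T R) : ∃ α' : (μ.sub p).T R, ∀ z : Pts R (μ.sub p).Tot,
    ext R (μ.W p).subtype (α'.toEquiv z) = α.toEquiv (ext R (μ.totIncl p) z) := by
  have hinj := ext_injective (R := R) _ (μ.W p).injective_subtype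
  have hrange : ∀ z : Pts R (μ.sub p).Tot, α.toEquiv (ext R (μ.totIncl p) z) ∈
      LinearMap.range (ext R (μ.W p).subtype) := by
    intro z
    rw [← extSub_eq_range]
    exact α.inducesGrId.map_W p _ (ext_mem_extSub_of_range _ (μ.totIncl_mem p) z)
  let a : Pts R (μ.sub p).Tot →ₗ[R] Pts R (μ.W p) :=
    (LinearEquiv.ofInjective _ hinj).symm.toLinearMap ∘ₗ
      (LinearMap.codRestrict (LinearMap.range (ext R (μ.W p).subtype))
        (α.toEquiv.toLinearMap ∘ₗ (ext R (μ.totIncl p) : Pts R (μ.sub p).Tot →ₗ[R] Pts R μ.Tot))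
        hrange)
  have ha : ∀ z, ext R (μ.W p).subtype (a z) = α.toEquiv (ext R (μ.totIncl p) z) := fun z =>
    congrArg Subtype.val ((LinearEquiv.ofInjective _ hinj).apply_symm_apply ⟨_, hrange z⟩)
  -- an element of `W_p M ⊗ R` that lies in `W_n M ⊗ R` lies in `W_n (W_p M) ⊗ R`
  have hmem : ∀ n (z : Pts R (μ.W p)), ext R (μ.W p).subtype z ∈ extSub R (μ.W n) →
      z ∈ extSub R ((μ.sub p).W n) := by
    intro n z hz
    rcases le_total n p with h | h
    · have h1 : ((μ.sub p).W n).map (μ.W p).subtype = μ.W n := by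
        refine (Submodule.map_comap_subtype _ _).trans ?_
        exact inf_eq_right.2 (μ.W_mono h)
      rw [← h1, ← map_extSub] at hz
      obtain ⟨y, hy, hyz⟩ := hz
      rwa [← hinj hyz]
    · have h1 : (μ.sub p).W n = ⊤ := Submodule.comap_subtype_eq_top.2 (μ.W_mono h)
      rw [h1, extSub_top]
      trivial
  refine ⟨T.ofLinearMap _ a ⟨fun n z hz => hmem n _ ?_, fun n u => hmem (n - 1) _ ?_⟩, ha⟩
  · rw [ha]
    exact α.inducesGrId.map_W n _ (ext_mem_extSub _ (μ.totIncl_mem_totW p n) hz)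
  · let j : (μ.sub p).W n →ₗ[ℚ] μ.W n := (μ.W p).subtype.restrict fun _ h => h
    have h1 : μ.totIncl p ∘ₗ ((μ.sub p).ι n ∘ₗ (μ.sub p).toGr n) =
        (μ.ι n ∘ₗ μ.toGr n) ∘ₗ j := LinearMap.ext fun x => μ.totIncl_ι p n _
    have h2 : (μ.W p).subtype ∘ₗ ((μ.sub p).W n).subtype = (μ.W n).subtype ∘ₗ j := rfl
    rw [map_sub, ha, ← ext_comp_apply, ← ext_comp_apply, h1, h2, ext_comp_apply _ j,
      ext_comp_apply _ j]
    exact α.inducesGrId.gr_id n _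

theorem exists_descend (p : ℤ) (α : μ.T R) : ∃ α' : (μ.quot p).T R, ∀ z : Pts R μ.Tot,
    α'.toEquiv (ext R (μ.totProj p) z) = ext R (μ.W p).mkQ (α.toEquiv z) := by
  let a : Pts R (μ.quot p).Tot →ₗ[R] Pts R (M ⧸ μ.W p) :=
    ext R (μ.W p).mkQ ∘ₗ α.toEquiv.toLinearMap ∘ₗ
      (ext R (μ.totSec p) : Pts R (μ.quot p).Tot →ₗ[R] Pts R μ.Tot)
  have ha : ∀ z : Pts R μ.Tot, a (ext R (μ.totProj p) z) =
      ext R (μ.W p).mkQ (α.toEquiv z) := by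
    intro z
    change ext R (μ.W p).mkQ (α.toEquiv (ext R (μ.totSec p) (ext R (μ.totProj p) z))) = _
    have h1 := ext_mem_extSub_of_range (R := R) _ (μ.totSec_sub_mem p) z
    have h2 := α.inducesGrId.map_W _ _ h1
    rw [extSub_eq_range] at h2
    obtain ⟨y, hy⟩ := h2
    have h3 : ext R (μ.W p).mkQ (ext R (μ.W p).subtype y) = 0 := by
      rw [← ext_comp_apply]
      have : (μ.W p).mkQ ∘ₗ (μ.W p).subtype = 0 := by ext; simp
      rw [this]
      simp [ext]
    rw [hy, ext_sub_apply, ext_comp_apply, ext_id_apply] at h3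
    have h4 : ext R (μ.W p).mkQ (α.toEquiv (ext R (μ.totSec p) (ext R (μ.totProj p) z) - z)) = 0 := h3
    rwa [map_sub, map_sub, sub_eq_zero] at h4
  refine ⟨T.ofLinearMap _ a ⟨fun n z hz => ?_, fun n u => ?_⟩, ha⟩
  · have h1 := extSub_mono (μ.totW_quot_le p n) hz
    rw [← map_extSub] at h1
    obtain ⟨y, hy, rfl⟩ := h1
    rw [ha]
    exact ext_mem_extSub _ (fun m hm => Submodule.mem_map_of_mem hm)
      (α.inducesGrId.map_W n y hy)
  · let j : μ.W n →ₗ[ℚ] (μ.quot p).W n :=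
      (μ.W p).mkQ.restrict fun _ h => Submodule.mem_map_of_mem h
    have hj : Function.Surjective j := by
      rintro ⟨_, y, hy, rfl⟩
      exact ⟨⟨y, hy⟩, rfl⟩
    obtain ⟨u, rfl⟩ := ext_surjective (R := R) j hj u
    have h1 : ((μ.quot p).ι n ∘ₗ (μ.quot p).toGr n) ∘ₗ j =
        μ.totProj p ∘ₗ (μ.ι n ∘ₗ μ.toGr n) := 
      LinearMap.ext fun x => (μ.totProj_ι p n (μ.toGr n x)).symm
    have h2 : ((μ.quot p).W n).subtype ∘ₗ j = (μ.W p).mkQ ∘ₗ (μ.W n).subtype := rfl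
    rw [← ext_comp_apply, ← ext_comp_apply, h1, h2, ext_comp_apply (μ.totProj p), ha,
      ext_comp_apply (μ.W p).mkQ, ← map_sub]
    exact ext_mem_extSub _ (fun m hm => Submodule.mem_map_of_mem hm) (α.inducesGrId.gr_id n u)

/-- The element `α_p` of `T(μ_p)(R)` obtained from `α ∈ T(μ)(R)` by restriction: the unique one that
is compatible with `α` and with the inclusions of `W_p M̃_ℂ ⊗ R` in `M̃_ℂ ⊗ R` and of `W_p M_ℂ ⊗ R` in
`M_ℂ ⊗ R`. -/
noncomputable def T.restrict (p : ℤ) (α : μ.T R) : (μ.sub p).T R :=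
  Classical.choose (exists_restrict p α)

theorem T.restrict_spec (p : ℤ) (α : μ.T R) (z : Pts R (μ.sub p).Tot) :
    ext R (μ.W p).subtype ((α.restrict p).toEquiv z) = α.toEquiv (ext R (μ.totIncl p) z) :=
  Classical.choose_spec (exists_restrict p α) z

theorem T.restrict_unique (p : ℤ) (α : μ.T R) (α' : (μ.sub p).T R)
    (h : ∀ z : Pts R (μ.sub p).Tot,
      ext R (μ.W p).subtype (α'.toEquiv z) = α.toEquiv (ext R (μ.totIncl p) z)) :
    α' = α.restrict p :=
  T.ext_linearMap fun z => ext_injective (R := R) _ (μ.W p).injective_subtype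
    ((h z).trans (α.restrict_spec p z).symm)

/-- The element `α_{>p}` of `T(μ_{>p})(R)` obtained from `α ∈ T(μ)(R)` by passing to the quotient:
the unique one compatible with `α` and with the projections from `M̃_ℂ ⊗ R` and `M_ℂ ⊗ R`. -/
noncomputable def T.descend (p : ℤ) (α : μ.T R) : (μ.quot p).T R :=
  Classical.choose (exists_descend p α)

theorem T.descend_spec (p : ℤ) (α : μ.T R) (z : Pts R μ.Tot) :
    (α.descend p).toEquiv (ext R (μ.totProj p) z) = ext R (μ.W p).mkQ (α.toEquiv z) :=
  Classical.choose_spec (exists_descend p α) z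

theorem T.descend_unique (p : ℤ) (α : μ.T R) (α' : (μ.quot p).T R)
    (h : ∀ z : Pts R μ.Tot,
      α'.toEquiv (ext R (μ.totProj p) z) = ext R (μ.W p).mkQ (α.toEquiv z)) :
    α' = α.descend p :=
  T.ext_linearMap fun z => by
    obtain ⟨z, rfl⟩ := ext_surjective (R := R) (μ.totProj p) (μ.totProj_surjective p) z
    rw [h, α.descend_spec]

variable (μ)

theorem totF_sub_le (p k : ℤ) :
    ((μ.sub p).totF k).map ((μ.totIncl p).baseChange ℂ) ≤ μ.totF k := by
  rw [totF, Submodule.map_iSup]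
  refine iSup_le fun n => ?_
  rw [← Submodule.map_comp, ← LinearMap.baseChange_comp]
  have h1 : μ.totIncl p ∘ₗ (μ.sub p).ι n = μ.ι n ∘ₗ μ.grIncl p n :=
    LinearMap.ext fun x => μ.totIncl_ι p n _
  rw [h1, LinearMap.baseChange_comp, Submodule.map_comp]
  exact (Submodule.map_mono (Submodule.map_comap_le _ _)).trans
    (le_iSup (fun n => ((μ.hodge n).F k).map ((μ.ι n).baseChange ℂ)) n)

theorem totF_map_retr (p k : ℤ) :
    (μ.totF k).map ((μ.totRetr p).baseChange ℂ) ≤ (μ.sub p).totF k := by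
  rw [totF, Submodule.map_iSup]
  refine iSup_le fun n => ?_
  rw [← Submodule.map_comp, ← LinearMap.baseChange_comp]
  rcases le_or_gt n p with h | h
  · rintro _ ⟨z, hz, rfl⟩
    obtain ⟨z, rfl⟩ := (baseChange_bijective _ (μ.grIncl_bijective h)).surjective z
    rw [← LinearMap.comp_apply, ← LinearMap.baseChange_comp]
    have h1 : (μ.totRetr p ∘ₗ μ.ι n) ∘ₗ μ.grIncl p n = (μ.sub p).ι n :=
      LinearMap.ext fun x => μ.totRetr_ι p n _
    rw [h1]
    exact (le_iSup (fun n => (((μ.sub p).hodge n).F k).map (((μ.sub p).ι n).baseChange ℂ)) n)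
      (Submodule.mem_map_of_mem hz)
  · have h1 : μ.totRetr p ∘ₗ μ.ι n = 0 := by
      refine LinearMap.ext fun x => ?_
      refine (DirectSum.lmap_lof _ _ _).trans ?_
      rw [dif_neg (not_le.2 h)]
      exact map_zero ((μ.sub p).ι n)
    rw [h1, LinearMap.baseChange_zero, Submodule.map_zero]
    exact bot_le

theorem totF_quot (p k : ℤ) :
    (μ.quot p).totF k = (μ.totF k).map ((μ.totProj p).baseChange ℂ) := by
  rw [totF, totF, Submodule.map_iSup]
  refine iSup_congr fun n => ?_
  conv_rhs => rw [← Submodule.map_comp, ← LinearMap.baseChange_comp]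
  have h1 : μ.totProj p ∘ₗ μ.ι n = (μ.quot p).ι n ∘ₗ μ.grProj p n :=
    LinearMap.ext fun x => μ.totProj_ι p n _
  rw [h1, LinearMap.baseChange_comp, Submodule.map_comp]

theorem totIncl_mem_totF (p k : ℤ) (z : Pts R (μ.sub p).Tot) :
    ext R (μ.totIncl p) z ∈ (μ.totF k).baseChange R ↔ z ∈ ((μ.sub p).totF k).baseChange R := by
  constructor
  · intro h
    have h1 : ext R (μ.totRetr p) (ext R (μ.totIncl p) z) ∈
        ((μ.totF k).baseChange R).map (ext R (μ.totRetr p)) := Submodule.mem_map_of_mem h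
    rw [map_baseChange, ← ext_comp_apply, μ.totRetr_comp, ext_id_apply] at h1
    exact baseChange_mono (μ.totF_map_retr p k) h1
  · intro h
    have h1 : ext R (μ.totIncl p) z ∈
        (((μ.sub p).totF k).baseChange R).map (ext R (μ.totIncl p)) := Submodule.mem_map_of_mem h
    rw [map_baseChange] at h1
    exact baseChange_mono (μ.totF_sub_le p k) h1

variable {μ}

theorem restrict_le (p k : ℤ) {α β : μ.T R}
    (h : ((μ.totF k).baseChange R).map α.toEquiv.toLinearMap ≤
      ((μ.totF k).baseChange R).map β.toEquiv.toLinearMap) :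
    (((μ.sub p).totF k).baseChange R).map (α.restrict p).toEquiv.toLinearMap ≤
      (((μ.sub p).totF k).baseChange R).map (β.restrict p).toEquiv.toLinearMap := by
  rintro _ ⟨z, hz, rfl⟩
  refine ⟨(β.restrict p).toEquiv.symm ((α.restrict p).toEquiv z), ?_,
    (β.restrict p).toEquiv.apply_symm_apply _⟩
  refine (μ.totIncl_mem_totF p k _).1 ?_
  obtain ⟨y, hy, hyz⟩ := h (Submodule.mem_map_of_mem ((μ.totIncl_mem_totF p k z).2 hz))
  have h1 : β.toEquiv (ext R (μ.totIncl p)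
      ((β.restrict p).toEquiv.symm ((α.restrict p).toEquiv z))) = β.toEquiv y := by
    rw [← T.restrict_spec, LinearEquiv.apply_symm_apply, T.restrict_spec]
    exact hyz.symm
  rw [β.toEquiv.injective h1]
  exact hy

theorem descend_map (p k : ℤ) (α : μ.T R) :
    (((μ.quot p).totF k).baseChange R).map (α.descend p).toEquiv.toLinearMap =
      (((μ.totF k).baseChange R).map α.toEquiv.toLinearMap).map (ext R (μ.W p).mkQ) := by
  rw [totF_quot, ← map_baseChange, ← Submodule.map_comp, ← Submodule.map_comp]
  congr 1
  exact LinearMap.ext fun z => α.descend_spec p z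

/-- The map `[α] ↦ [α_p]`, from `S(μ)(R)` to `S(μ_p)(R)`. -/
noncomputable def SPts.restrict (p : ℤ) : μ.SPts R → (μ.sub p).SPts R :=
  Quotient.lift (fun α : μ.T R => (α.restrict p).cls) fun α β h => by
    have h1 := T.cls_eq_iff.1 (Quotient.sound h : α.cls = β.cls)
    exact T.cls_eq_iff.2 fun k => le_antisymm
      (restrict_le p k (h1 k).le) (restrict_le p k (h1 k).ge)

/-- The map `[α] ↦ [α_{>p}]`, from `S(μ)(R)` to `S(μ_{>p})(R)`. -/
noncomputable def SPts.descend (p : ℤ) : μ.SPts R → (μ.quot p).SPts R :=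
  Quotient.lift (fun α : μ.T R => (α.descend p).cls) fun α β h => by
    have h1 := T.cls_eq_iff.1 (Quotient.sound h : α.cls = β.cls)
    exact T.cls_eq_iff.2 fun k => by rw [descend_map, descend_map, h1 k]

variable {R' : Type w} [CommRing R'] [Algebra ℂ R']

theorem T.map_restrict (p : ℤ) (f : R →ₐ[ℂ] R') (α : μ.T R) :
    (α.map f).restrict p = (α.restrict p).map f := by
  refine (T.restrict_unique p _ _ fun z => ?_).symm
  have : ext R' (μ.W p).subtype ∘ₗ chgMap f (α.restrict p).toEquiv.toLinearMap =
      chgMap f α.toEquiv.toLinearMap ∘ₗ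
        (ext R' (μ.totIncl p) : Pts R' (μ.sub p).Tot →ₗ[R'] Pts R' μ.Tot) := by
    refine hom_ext_chg f fun z => ?_
    rw [LinearMap.comp_apply, LinearMap.comp_apply, chgMap_chg, chg_ext, chg_ext, chgMap_chg]
    exact congrArg _ (α.restrict_spec p z)
  exact LinearMap.congr_fun this z

theorem T.map_descend (p : ℤ) (f : R →ₐ[ℂ] R') (α : μ.T R) :
    (α.map f).descend p = (α.descend p).map f := by
  refine (T.descend_unique p _ _ fun z => ?_).symm
  have : chgMap f (α.descend p).toEquiv.toLinearMap ∘ₗ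
        (ext R' (μ.totProj p) : Pts R' μ.Tot →ₗ[R'] Pts R' (μ.quot p).Tot) =
      ext R' (μ.W p).mkQ ∘ₗ chgMap f α.toEquiv.toLinearMap := by
    refine hom_ext_chg f fun z => ?_
    rw [LinearMap.comp_apply, LinearMap.comp_apply, chgMap_chg, chg_ext, chg_ext, chgMap_chg]
    exact congrArg _ (α.descend_spec p z)
  exact LinearMap.congr_fun this z

end Theta

/-- The morphism `Θ_p : S(μ) → S(μ_p) × S(μ_{>p})`, `[α] ↦ ([α_p], [α_{>p}])`. -/
noncomputable def Theta (p : ℤ) : μ.S ⟶ FunctorToTypes.prod (μ.sub p).S (μ.quot p).S where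
  app R := ↾fun s : μ.SPts R => (s.restrict p, s.descend p)
  naturality R R' f := by
    refine ConcreteCategory.hom_ext _ _ fun s => ?_
    induction s using Quotient.inductionOn with
    | _ α =>
      exact Prod.ext (congrArg T.cls (α.map_restrict p f.hom))
        (congrArg T.cls (α.map_descend p f.hom))

/-! ## Sections of `M_ℂ → M_ℂ / W_p M_ℂ`, and the fibers of `Θ_p` -/

section Fiber

variable (p : ℤ) (x : (μ.sub p).SPts ℂ) (y : (μ.quot p).SPts ℂ)

section Points

variable (R : Type w) [CommRing R] [Algebra ℂ R]

/-- The `R`-linear sections of `M_ℂ ⊗ R → (M_ℂ / W_p M_ℂ) ⊗ R`. -/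
@[ext]
structure Sec where
  toLin : Pts R (M ⧸ μ.W p) →ₗ[R] Pts R M
  isSection : ∀ z, ext R (μ.W p).mkQ (toLin z) = z

/-- The `R`-linear maps `(M_ℂ / W_p M_ℂ) ⊗ R → W_p M_ℂ ⊗ R` that are compatible with the filtrations
`F_y` and `F_x`. -/
def F0Hom : Submodule R (Pts R (M ⧸ μ.W p) →ₗ[R] Pts R (μ.W p)) where
  carrier := {f | ∀ k, ∀ z ∈ ((μ.quot p).hodgeF y k).baseChange R,
    f z ∈ ((μ.sub p).hodgeF x k).baseChange R}
  add_mem' hf hg k z hz := Submodule.add_mem _ (hf k z hz) (hg k z hz)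
  zero_mem' _ _ _ := Submodule.zero_mem _
  smul_mem' c _ hf k z hz := Submodule.smul_mem _ c (hf k z hz)

/-- The equivalence relation on sections given by the additive action of `F⁰_{x,y} Hom`. -/
def SecSetoid : Setoid (μ.Sec p R) where
  r ψ ψ' := ∃ f ∈ μ.F0Hom p x y R, ψ'.toLin = ψ.toLin + ext R (μ.W p).subtype ∘ₗ f
  iseqv :=
    { refl := fun ψ => ⟨0, Submodule.zero_mem _, by simp⟩
      symm := by
        rintro ψ ψ' ⟨f, hf, h⟩
        exact ⟨(-1 : R) • f, Submodule.smul_mem _ _ hf, LinearMap.ext fun z => by simp [h]⟩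
      trans := by
        rintro ψ ψ' ψ'' ⟨f, hf, h⟩ ⟨g, hg, h'⟩
        exact ⟨f + g, Submodule.add_mem _ hf hg, by rw [h', h, LinearMap.comp_add, add_assoc]⟩ }

/-- The `R`-points of `Sec (M_ℂ → M_ℂ / W_p M_ℂ)ᵃ / F⁰_{x,y} Hom (M_ℂ / W_p M_ℂ, W_p M_ℂ)ᵃ`. As torsors
for a vector group over an affine scheme are trivial, they are the quotient of the set of sections
over `R` by the group of compatible maps over `R`. -/
def SecPts : Type max u w := Quotient (μ.SecSetoid p x y R)

variable {μ p R}

/-- The class of a section. -/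
def Sec.cls (ψ : μ.Sec p R) : μ.SecPts p x y R := Quotient.mk (μ.SecSetoid p x y R) ψ

variable (R) in
/-- A `ℂ`-linear section of `M_ℂ → M_ℂ / W_p M_ℂ` gives a section after any extension of scalars. -/
noncomputable def Sec.ofComplex (ψ : (ℂ ⊗[ℚ] (M ⧸ μ.W p)) →ₗ[ℂ] (ℂ ⊗[ℚ] M))
    (hψ : ∀ v, (μ.W p).mkQ.baseChange ℂ (ψ v) = v) : μ.Sec p R where
  toLin := ψ.baseChange R
  isSection z := by
    have h : (μ.W p).mkQ.baseChange ℂ ∘ₗ ψ = LinearMap.id := LinearMap.ext hψ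
    rw [ext, ← LinearMap.comp_apply, ← LinearMap.baseChange_comp, h, LinearMap.baseChange_id,
      LinearMap.id_apply]

variable {R' : Type w} [CommRing R'] [Algebra ℂ R']

/-- The map on sections induced by `R → R'`. -/
noncomputable def Sec.map (f : R →ₐ[ℂ] R') (ψ : μ.Sec p R) : μ.Sec p R' where
  toLin := chgMap f ψ.toLin
  isSection := by
    refine LinearMap.congr_fun (f := ext R' (μ.W p).mkQ ∘ₗ chgMap f ψ.toLin)
      (g := LinearMap.id) (hom_ext_chg f fun z => ?_)
    rw [LinearMap.comp_apply, chgMap_chg, chg_ext, ψ.isSection, LinearMap.id_apply]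

variable {x y}

/-- The map on classes of sections induced by `R → R'`. -/
noncomputable def SecPts.map (f : R →ₐ[ℂ] R') : μ.SecPts p x y R → μ.SecPts p x y R' :=
  Quotient.map (Sec.map f) (by
    rintro ψ ψ' ⟨g, hg, h⟩
    refine ⟨chgMap f g, fun k => ?_, ?_⟩
    · refine baseChange_induction f _ _ _ fun z hz => ?_
      rw [chgMap_chg]
      exact chg_mem_baseChange f _ (hg k z hz)
    · change chgMap f ψ'.toLin = chgMap f ψ.toLin + _
      rw [h, chgMap_add, chgMap_comp, chgMap_baseChange])

/-- For `α ∈ T(μ_p)(R)`, `β ∈ T(μ_{>p})(R)` and a section `ψ`, the map `γ : M̃_ℂ ⊗ R → M_ℂ ⊗ R` is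
`γ_ψ = α + ψ β`, formed with respect to the canonical decomposition
`M̃_ℂ = W_p M̃_ℂ ⊕ M̃_ℂ / W_p M̃_ℂ`. -/
structure IsGluing (α : (μ.sub p).T R) (β : (μ.quot p).T R) (ψ : μ.Sec p R) (γ : μ.T R) : Prop where
  apply_totIncl : ∀ z : Pts R (μ.sub p).Tot,
    γ.toEquiv (ext R (μ.totIncl p) z) = ext R (μ.W p).subtype (α.toEquiv z)
  apply_totSec : ∀ z : Pts R (μ.quot p).Tot,
    γ.toEquiv (ext R (μ.totSec p) z) = ψ.toLin (β.toEquiv z)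

end Points

/-- The functor of points of the quotient
`Sec (M_ℂ → M_ℂ / W_p M_ℂ)ᵃ / F⁰_{x,y} Hom (M_ℂ / W_p M_ℂ, W_p M_ℂ)ᵃ`. -/
noncomputable def SecQuot : CommAlgCat.{0} ℂ ⥤ Type u where
  obj R := μ.SecPts p x y R
  map f := ↾(SecPts.map f.hom)
  map_id R := by
    ext s
    induction s using Quotient.inductionOn with
    | _ ψ => exact congrArg (Sec.cls x y) (Sec.ext (chgMap_id' ψ.toLin))
  map_comp f g := by
    ext s
    induction s using Quotient.inductionOn with
    | _ ψ => exact congrArg (Sec.cls x y) (Sec.ext (chgMap_comp' g.hom f.hom ψ.toLin))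

/-- The (functor of points of the) fiber `S(μ)_{(x,y)}` of `Θ_p` above the complex point `(x, y)`. -/
noncomputable def fiber : Subfunctor μ.S where
  obj R := {s | (μ.Theta p).app R s =
    (FunctorToTypes.prod (μ.sub p).S (μ.quot p).S).map
      (CommAlgCat.ofHom (Algebra.ofId ℂ R) : CommAlgCat.of ℂ ℂ ⟶ R) (x, y)}
  map {R R'} f := by
    intro s hs
    have h1 : (μ.Theta p).app R' (μ.S.map f s) =
        (FunctorToTypes.prod (μ.sub p).S (μ.quot p).S).map f ((μ.Theta p).app R s) :=
      NatTrans.naturality_apply (μ.Theta p) f s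
    have h2 : (CommAlgCat.ofHom (Algebra.ofId ℂ R) : CommAlgCat.of ℂ ℂ ⟶ R) ≫ f =
        CommAlgCat.ofHom (Algebra.ofId ℂ R') := by
      ext
    change (μ.Theta p).app R' (μ.S.map f s) = _
    rw [h1, hs, ← h2]
    exact (Functor.map_comp_apply _ _ _ _).symm

end Fiber

end Triple

/-- A functor on commutative `ℂ`-algebras is (the functor of points of) an affine space of dimension
`d` over `ℂ`, i.e. it is represented by `Spec ℂ[t_1, …, t_d]`. -/
def IsAffineSpace (X : CommAlgCat.{0} ℂ ⥤ Type u) (d : ℕ) : Prop :=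
  Nonempty (X.CorepresentableBy (CommAlgCat.of ℂ (MvPolynomial (Fin d) ℂ)))

end MHS

/-!
The fiber of `Θ_p` is governed by Hodge filtrations: by `T.cls_eq_iff` a point of `S(μ)(R)` is
determined by the filtration `α (F M̃_ℂ ⊗ R)` of `M_ℂ ⊗ R`. As `F M̃_ℂ` is compatible with the
canonical decomposition of `M̃_ℂ` into `W_p M̃_ℂ` and `M̃_ℂ / W_p M̃_ℂ`, a gluing `γ = α + ψ β`
has the filtration `α (F) + ψ (β (F))`, which for representatives of `x` and `y` is
`F_x + ψ (F_y)` (`IsGluing.map_totF_eq_secF`). It depends on `x`, `y` and `ψ` only, so that `[α + ψ β]`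
does not depend on the representatives. Two sections give the same filtration if and only if their
difference maps `F_y` to `F_x` (`secF_eq_iff`); this is injectivity. For surjectivity, every
`γ ∈ T(μ)(R)` is itself the gluing of `γ_p` and `γ_{>p}` along the section `γ ∘ totSec ∘ γ_{>p}⁻¹`
(`exists_isGluing_restrict_descend`); over a point of the fiber, `γ_p` and `γ_{>p}` are
representatives of `x` and `y` over `R`.

At a complex point, `α` identifies the component of degree `n` of `M̃` with `Gr^W_n M`, so that
the filtration induced by `α (F)` on `Gr^W_n M` is the given one (`inducedF_hodgeF`), and one has
a mixed Hodge structure associated to `μ`.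

For the affine space, fix a section `ψ₀` over `ℂ` and linear maps `e_1, …, e_d` whose classes form
a basis of `Hom (M_ℂ / W_p M_ℂ, W_p M_ℂ)` modulo `F⁰_{x,y} Hom`. Then `r ↦ ψ₀ + ∑ r_j e_j` is a
bijection from `R^d` to classes of sections over `R`: injectivity is reduced to the case `R = ℂ`
by linear functionals `R → ℂ`, and surjectivity holds because `Hom` commutes with extension of
scalars. Finally `d = 0` would mean that every linear map is compatible with the filtrations. For
`k` maximal with `F_y^k ≠ 0` this forces `F_x^k` to be everything, and Hodge symmetry then gives
`n ≤ 2 k ≤ m` for a weight `n > p` of `M / W_p M` and a weight `m ≤ p` of `W_p M`, which is absurd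
(`compatHom_ne_top`).
-/

namespace MHS

/-! ### Extension of scalars -/

section Scalars

variable {V : Type u} [AddCommGroup V] [Module ℂ V] {V' : Type v} [AddCommGroup V'] [Module ℂ V']

theorem map_lid_baseChange (P : Submodule ℂ V) :
    (P.baseChange ℂ).map (TensorProduct.lid ℂ V).toLinearMap = P := by
  refine le_antisymm ?_ fun v hv => ?_
  · rintro _ ⟨_, ⟨y, rfl⟩, rfl⟩
    induction y with
    | zero => simp
    | add a b ha hb => rw [map_add, map_add]; exact P.add_mem ha hb
    | tmul a v => simpa using P.smul_mem a v.2
  · exact ⟨1 ⊗ₜ v, Submodule.tmul_mem_baseChange_of_mem 1 hv, by simp⟩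

theorem map_lid_symm (P : Submodule ℂ V) :
    P.map (TensorProduct.lid ℂ V).symm.toLinearMap = P.baseChange ℂ := by
  conv_lhs => rw [← map_lid_baseChange P]
  rw [← Submodule.map_comp]
  have h : (TensorProduct.lid ℂ V).symm.toLinearMap ∘ₗ (TensorProduct.lid ℂ V).toLinearMap =
      LinearMap.id := LinearMap.ext fun z => (TensorProduct.lid ℂ V).symm_apply_apply z
  rw [h, Submodule.map_id]

theorem one_tmul_mem_baseChange_iff {P : Submodule ℂ V} {v : V} :
    (1 : ℂ) ⊗ₜ[ℂ] v ∈ P.baseChange ℂ ↔ v ∈ P := by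
  refine ⟨fun h => ?_, fun h => Submodule.tmul_mem_baseChange_of_mem 1 h⟩
  have h1 := Submodule.mem_map_of_mem (f := (TensorProduct.lid ℂ V).toLinearMap) h
  rw [map_lid_baseChange] at h1
  simpa using h1

theorem map_baseChange_map_lid (P : Submodule ℂ V) (g : V →ₗ[ℂ] V') :
    ((P.baseChange ℂ).map (g.baseChange ℂ)).map (TensorProduct.lid ℂ V').toLinearMap =
      P.map g := by
  rw [map_baseChange, map_lid_baseChange]

/-- A `ℂ`-linear map defined over `ℂ` in the form `ℂ ⊗ V → ℂ ⊗ V'` is extended to `R` by first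
identifying `ℂ ⊗ V` with `V`. -/
theorem chgMap_ofId (R : Type) [CommRing R] [Algebra ℂ R] (g : ℂ ⊗[ℂ] V →ₗ[ℂ] ℂ ⊗[ℂ] V') :
    chgMap (Algebra.ofId ℂ R) g =
      ((TensorProduct.lid ℂ V').toLinearMap ∘ₗ g ∘ₗ
        (TensorProduct.lid ℂ V).symm.toLinearMap).baseChange R := by
  have h : ∀ z : ℂ ⊗[ℂ] V',
      (Algebra.ofId ℂ R).toLinearMap.rTensor V' z = 1 ⊗ₜ TensorProduct.lid ℂ V' z := by
    intro z
    induction z with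
    | zero => simp
    | add a b ha hb => rw [map_add, map_add, TensorProduct.tmul_add, ha, hb]
    | tmul a v =>
      simp [Algebra.ofId_apply, Algebra.algebraMap_eq_smul_one, TensorProduct.smul_tmul]
  ext v
  simp [chgMap, chg, h]

end Scalars

section

variable {R : Type w} [CommRing R] [Algebra ℂ R] {N : Type u} [AddCommGroup N] [Module ℚ N]
  {L : Type v} [AddCommGroup L] [Module ℚ L]

theorem ext_add_apply (g h : N →ₗ[ℚ] L) (z : Pts R N) :
    ext R (g + h) z = ext R g z + ext R h z := by
  simp only [ext, LinearMap.baseChange_add, LinearMap.add_apply]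

theorem ext_zero_apply (z : Pts R N) : ext R (0 : N →ₗ[ℚ] L) z = 0 := by
  simp only [ext, LinearMap.baseChange_zero, LinearMap.zero_apply]

end

/-! ### The splitting of the graded space and of the underlying space -/

namespace WeightFiltration

variable {M : Type u} [AddCommGroup M] [Module ℚ M] (𝓦 : WeightFiltration M) (p : ℤ)

theorem totIncl_comp_totRetr_add :
    𝓦.totIncl p ∘ₗ 𝓦.totRetr p + 𝓦.totSec p ∘ₗ 𝓦.totProj p = LinearMap.id := by
  refine LinearMap.ext fun x => ?_
  induction x using tot_induction with
  | h0 => simp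
  | hadd x y hx hy => rw [map_add, hx, hy, map_add]
  | hι n g =>
    have h1 : 𝓦.totSec p ((𝓦.quot p).ι n (𝓦.grProj p n g)) = 𝓦.ι n _ :=
      DirectSum.lmap_lof _ _ _
    have h2 : 𝓦.totRetr p (𝓦.ι n g) = (𝓦.sub p).ι n _ := DirectSum.lmap_lof _ _ _
    rw [LinearMap.add_apply, LinearMap.comp_apply, LinearMap.comp_apply, totProj_ι, h1, h2,
      totIncl_ι, LinearMap.id_apply]
    rcases le_or_gt n p with h | h
    · rw [dif_pos h, dif_neg (not_lt.2 h), LinearMap.zero_apply, map_zero, add_zero]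
      exact congrArg _ ((LinearEquiv.ofBijective _ (𝓦.grIncl_bijective h)).apply_symm_apply g)
    · rw [dif_pos h, dif_neg (not_le.2 h), LinearMap.zero_apply, map_zero, map_zero, zero_add]
      exact congrArg _ ((LinearEquiv.ofBijective _ (𝓦.grProj_bijective h)).symm_apply_apply g)

theorem totProj_comp_totIncl : 𝓦.totProj p ∘ₗ 𝓦.totIncl p = 0 := by
  refine LinearMap.ext fun x => ?_
  induction x using tot_induction with
  | h0 => simp
  | hadd x y hx hy => rw [map_add, hx, hy, map_add]
  | hι n g =>
    rw [LinearMap.comp_apply, totIncl_ι, totProj_ι, LinearMap.zero_apply]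
    rcases le_or_gt n p with h | h
    · have := 𝓦.subsingleton_gr_quot h
      rw [Subsingleton.elim (𝓦.grProj p n _) 0, map_zero]
    · have := 𝓦.subsingleton_gr_sub h
      rw [Subsingleton.elim g 0, map_zero, map_zero, map_zero]

theorem totProj_comp_totSec : 𝓦.totProj p ∘ₗ 𝓦.totSec p = LinearMap.id := by
  have h := congrArg (fun f => 𝓦.totProj p ∘ₗ f) (𝓦.totIncl_comp_totRetr_add p)
  refine LinearMap.ext fun x => ?_
  obtain ⟨x, rfl⟩ := 𝓦.totProj_surjective p x
  have h1 := LinearMap.congr_fun h x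
  have h2 := LinearMap.congr_fun (𝓦.totProj_comp_totIncl p) (𝓦.totRetr p x)
  simp only [LinearMap.comp_apply, LinearMap.add_apply, map_add, LinearMap.id_apply,
    LinearMap.zero_apply] at h1 h2 ⊢
  rwa [h2, zero_add] at h1

theorem totRetr_comp_totSec : 𝓦.totRetr p ∘ₗ 𝓦.totSec p = 0 := by
  refine LinearMap.ext fun x => 𝓦.totIncl_injective p ?_
  have h1 := LinearMap.congr_fun (𝓦.totIncl_comp_totRetr_add p) (𝓦.totSec p x)
  have h2 := LinearMap.congr_fun (𝓦.totProj_comp_totSec p) x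
  simp only [LinearMap.comp_apply, LinearMap.add_apply, LinearMap.id_apply,
    LinearMap.zero_apply, map_zero] at h1 h2 ⊢
  rwa [h2, add_eq_right] at h1

theorem totRetr_mem_totW (n : ℤ) {x : 𝓦.Tot} (hx : x ∈ 𝓦.totW n) :
    𝓦.totRetr p x ∈ (𝓦.sub p).totW n := by
  have : 𝓦.totW n ≤ ((𝓦.sub p).totW n).comap (𝓦.totRetr p) := by
    refine iSup₂_le fun m hm => ?_
    rintro _ ⟨g, rfl⟩
    have h2 : 𝓦.totRetr p (𝓦.ι m g) = (𝓦.sub p).ι m _ := DirectSum.lmap_lof _ _ _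
    rw [Submodule.mem_comap, h2]
    exact (𝓦.sub p).range_ι_le hm ⟨_, rfl⟩
  exact this hx

theorem totProj_mem_totW (n : ℤ) {x : 𝓦.Tot} (hx : x ∈ 𝓦.totW n) :
    𝓦.totProj p x ∈ (𝓦.quot p).totW n := by
  have : 𝓦.totW n ≤ ((𝓦.quot p).totW n).comap (𝓦.totProj p) := by
    refine iSup₂_le fun m hm => ?_
    rintro _ ⟨g, rfl⟩
    rw [Submodule.mem_comap, totProj_ι]
    exact (𝓦.quot p).range_ι_le hm ⟨_, rfl⟩
  exact this hx

/-- A splitting `id = i ρ + s π` of `0 → W_p M → M → M / W_p M → 0` over `ℚ`. After extension of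
scalars it gives the exactness of this sequence and its compatibility with `W`. -/
theorem exists_split : ∃ (ρ : M →ₗ[ℚ] 𝓦.W p) (s : (M ⧸ 𝓦.W p) →ₗ[ℚ] M),
    (𝓦.W p).subtype ∘ₗ ρ + s ∘ₗ (𝓦.W p).mkQ = LinearMap.id ∧
    (𝓦.W p).mkQ ∘ₗ s = LinearMap.id := by
  obtain ⟨s, hs⟩ := (𝓦.W p).mkQ.exists_rightInverse_of_surjective
    (LinearMap.range_eq_top.2 (Submodule.mkQ_surjective _))
  refine ⟨LinearMap.codRestrict _ (LinearMap.id - s ∘ₗ (𝓦.W p).mkQ) fun m => ?_, s, ?_, hs⟩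
  · have h := LinearMap.congr_fun hs ((𝓦.W p).mkQ m)
    refine (Submodule.Quotient.mk_eq_zero _).1 ?_
    exact (map_sub (𝓦.W p).mkQ m _).trans (sub_eq_zero.2 h.symm)
  · ext m
    simp

variable {R : Type w} [CommRing R] [Algebra ℂ R]

theorem ext_mkQ_subtype (z : Pts R (𝓦.W p)) :
    ext R (𝓦.W p).mkQ (ext R (𝓦.W p).subtype z) = 0 := by
  rw [← ext_comp_apply]
  have : (𝓦.W p).mkQ ∘ₗ (𝓦.W p).subtype = 0 := by ext; simp
  rw [this, ext_zero_apply]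

theorem exists_ext_subtype_eq {z : Pts R M} (hz : ext R (𝓦.W p).mkQ z = 0) :
    ∃ t, ext R (𝓦.W p).subtype t = z := by
  obtain ⟨ρ, s, h, -⟩ := 𝓦.exists_split p
  refine ⟨ext R ρ z, ?_⟩
  conv_rhs => rw [← ext_id_apply z, ← h, ext_add_apply, ext_comp_apply, ext_comp_apply, hz,
    map_zero, add_zero]

/-- For `p ≤ n` the preimage of `W_n (M / W_p M)` is `W_n M`, also after extension of scalars. -/
theorem mem_extSub_of_mkQ_mem {n : ℤ} (h : p ≤ n) {z : Pts R M}
    (hz : ext R (𝓦.W p).mkQ z ∈ extSub R ((𝓦.quot p).W n)) : z ∈ extSub R (𝓦.W n) := by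
  obtain ⟨ρ, s, hs, hs'⟩ := 𝓦.exists_split p
  rw [← ext_id_apply z, ← hs, ext_add_apply, ext_comp_apply, ext_comp_apply]
  refine Submodule.add_mem _ ?_ (ext_mem_extSub s ?_ hz)
  · exact ext_mem_extSub_of_range _ (fun m => 𝓦.W_mono h m.2) _
  · rintro _ ⟨m, hm, rfl⟩
    have h1 : s ((𝓦.W p).mkQ m) = m - ρ m := by
      have := LinearMap.congr_fun hs m
      rw [eq_sub_iff_add_eq, add_comm]
      exact this
    rw [h1]
    exact Submodule.sub_mem _ hm (𝓦.W_mono h (ρ m).2)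

theorem extSub_quot_eq_bot {n : ℤ} (h : n ≤ p) : extSub R ((𝓦.quot p).W n) = ⊥ := by
  have : (𝓦.quot p).W n = ⊥ := by
    refine (Submodule.eq_bot_iff _).2 ?_
    rintro _ ⟨m, hm, rfl⟩
    exact (Submodule.Quotient.mk_eq_zero _).2 (𝓦.W_mono h hm)
  rw [this, extSub_bot]

end WeightFiltration

/-! ### Gluing -/

namespace Triple

variable {M : Type u} [AddCommGroup M] [Module ℚ M] {μ : Triple M} {p : ℤ}

section Points

variable {R : Type w} [CommRing R] [Algebra ℂ R]

theorem totIncl_totRetr_add (z : Pts R μ.Tot) :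
    ext R (μ.totIncl p) (ext R (μ.totRetr p) z) +
      ext R (μ.totSec p) (ext R (μ.totProj p) z) = z := by
  conv_rhs => rw [← ext_id_apply z, ← μ.totIncl_comp_totRetr_add p,
    ext_add_apply, ext_comp_apply, ext_comp_apply]

/-- The map `α + ψ β` defines a point of `T(μ)` for every section `ψ`. No condition on `ψ` is
needed: for `n ≥ p` the preimage of `W_n (M / W_p M)` is `W_n M`, and for `n ≤ p` the former is zero. -/
theorem inducesGrId_glue (α : (μ.sub p).T R) (β : (μ.quot p).T R) (ψ : μ.Sec p R) :
    μ.InducesGrId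
      (ext R (μ.W p).subtype ∘ₗ α.toEquiv.toLinearMap ∘ₗ
          (ext R (μ.totRetr p) : Pts R μ.Tot →ₗ[R] Pts R (μ.sub p).Tot) +
        ψ.toLin ∘ₗ β.toEquiv.toLinearMap ∘ₗ
          (ext R (μ.totProj p) : Pts R μ.Tot →ₗ[R] Pts R (μ.quot p).Tot)) where
  map_W n z hz := by
    refine Submodule.add_mem _ ?_ ?_
    · exact ext_mem_extSub _ (fun _ h => h) (α.inducesGrId.map_W n _
        (ext_mem_extSub _ (fun _ h => μ.totRetr_mem_totW p n h) hz))
    · have h1 := β.inducesGrId.map_W n _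
        (ext_mem_extSub _ (fun _ h => μ.totProj_mem_totW p n h) hz)
      rcases le_total p n with h | h
      · refine μ.mem_extSub_of_mkQ_mem p h ?_
        rw [LinearMap.comp_apply, ψ.isSection]
        exact h1
      · rw [μ.extSub_quot_eq_bot p h, Submodule.mem_bot] at h1
        rw [LinearMap.comp_apply, LinearMap.comp_apply, h1, map_zero]
        exact Submodule.zero_mem _
  gr_id n u := by
    rcases le_or_gt n p with h | h
    · let j : (μ.sub p).W n →ₗ[ℚ] μ.W n := (μ.W p).subtype.restrict fun _ h => h
      have hj : Function.Surjective j := fun m => ⟨⟨⟨m.1, μ.W_mono h m.2⟩, m.2⟩, rfl⟩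
      obtain ⟨u, rfl⟩ := ext_surjective (R := R) j hj u
      have h1 : μ.totIncl p ∘ₗ ((μ.sub p).ι n ∘ₗ (μ.sub p).toGr n) =
          (μ.ι n ∘ₗ μ.toGr n) ∘ₗ j := LinearMap.ext fun x => μ.totIncl_ι p n _
      have h2 : (μ.W p).subtype ∘ₗ ((μ.sub p).W n).subtype = (μ.W n).subtype ∘ₗ j := rfl
      have h3 : ∀ z : Pts R (μ.sub p).Tot,
          ext R (μ.totRetr p) (ext R (μ.totIncl p) z) = z := fun z => by
        rw [← ext_comp_apply, μ.totRetr_comp, ext_id_apply]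
      have h4 : ∀ z : Pts R (μ.sub p).Tot,
          ext R (μ.totProj p) (ext R (μ.totIncl p) z) = 0 := fun z => by
        rw [← ext_comp_apply, μ.totProj_comp_totIncl, ext_zero_apply]
      rw [← ext_comp_apply, ← ext_comp_apply, ← h1, ← h2, ext_comp_apply (μ.totIncl p),
        LinearMap.add_apply, LinearMap.comp_apply, LinearMap.comp_apply, LinearMap.comp_apply,
        LinearMap.comp_apply, h3, h4, map_zero, map_zero, add_zero, ext_comp_apply (μ.W p).subtype,
        ← map_sub]
      exact ext_mem_extSub _ (fun _ h => h) (α.inducesGrId.gr_id n u)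
    · refine μ.mem_extSub_of_mkQ_mem p (by lia) ?_
      let j : μ.W n →ₗ[ℚ] (μ.quot p).W n :=
        (μ.W p).mkQ.restrict fun _ h => Submodule.mem_map_of_mem h
      have h1 : ((μ.quot p).ι n ∘ₗ (μ.quot p).toGr n) ∘ₗ j =
          μ.totProj p ∘ₗ (μ.ι n ∘ₗ μ.toGr n) :=
        LinearMap.ext fun x => (μ.totProj_ι p n (μ.toGr n x)).symm
      have h2 : ((μ.quot p).W n).subtype ∘ₗ j = (μ.W p).mkQ ∘ₗ (μ.W n).subtype := rfl
      rw [map_sub, LinearMap.add_apply, map_add, LinearMap.comp_apply,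
        WeightFiltration.ext_mkQ_subtype, zero_add, LinearMap.comp_apply, ψ.isSection,
        LinearMap.comp_apply, ← ext_comp_apply,
        ← ext_comp_apply, ← h1, ← h2, ext_comp_apply _ j, ext_comp_apply _ j]
      exact β.inducesGrId.gr_id n _

theorem exists_isGluing (α : (μ.sub p).T R) (β : (μ.quot p).T R) (ψ : μ.Sec p R) :
    ∃ γ : μ.T R, IsGluing α β ψ γ := by
  refine ⟨T.ofLinearMap μ _ (inducesGrId_glue α β ψ), fun z => ?_, fun z => ?_⟩
  · change ext R (μ.W p).subtype (α.toEquiv (ext R (μ.totRetr p) (ext R (μ.totIncl p) z))) +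
      ψ.toLin (β.toEquiv (ext R (μ.totProj p) (ext R (μ.totIncl p) z))) = _
    rw [← ext_comp_apply, μ.totRetr_comp, ext_id_apply, ← ext_comp_apply,
      μ.totProj_comp_totIncl, ext_zero_apply, map_zero, map_zero, add_zero]
  · change ext R (μ.W p).subtype (α.toEquiv (ext R (μ.totRetr p) (ext R (μ.totSec p) z))) +
      ψ.toLin (β.toEquiv (ext R (μ.totProj p) (ext R (μ.totSec p) z))) = _
    rw [← ext_comp_apply, μ.totRetr_comp_totSec, ext_zero_apply,
      ← ext_comp_apply, μ.totProj_comp_totSec, ext_id_apply, map_zero, map_zero, zero_add]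

theorem totF_map_sec (k : ℤ) :
    ((μ.quot p).totF k).map ((μ.totSec p).baseChange ℂ) ≤ μ.totF k := by
  rw [totF_quot, totF, Submodule.map_iSup, Submodule.map_iSup]
  refine iSup_le fun n => ?_
  rw [← Submodule.map_comp, ← Submodule.map_comp, ← LinearMap.baseChange_comp,
    ← LinearMap.baseChange_comp]
  rcases le_or_gt n p with h | h
  · have h1 : (μ.totSec p ∘ₗ μ.totProj p) ∘ₗ μ.ι n = 0 := by
      refine LinearMap.ext fun g => ?_
      have := μ.subsingleton_gr_quot h
      rw [LinearMap.comp_apply, LinearMap.comp_apply, μ.totProj_ι,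
        Subsingleton.elim (μ.grProj p n g) 0, map_zero, map_zero, LinearMap.zero_apply]
    rw [h1, LinearMap.baseChange_zero, Submodule.map_zero]
    exact bot_le
  · have h1 : (μ.totSec p ∘ₗ μ.totProj p) ∘ₗ μ.ι n = μ.ι n := by
      refine LinearMap.ext fun g => ?_
      have h2 : μ.totSec p ((μ.quot p).ι n (μ.grProj p n g)) = μ.ι n _ :=
        DirectSum.lmap_lof _ _ _
      rw [LinearMap.comp_apply, LinearMap.comp_apply, μ.totProj_ι, h2, dif_pos h]
      exact congrArg _ ((LinearEquiv.ofBijective _ (μ.grProj_bijective h)).symm_apply_apply g)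
    rw [h1]
    exact le_iSup (fun n => ((μ.hodge n).F k).map ((μ.ι n).baseChange ℂ)) n

variable (μ p R) in
/-- `F^k M̃_ℂ` is compatible with the decomposition `M̃_ℂ = W_p M̃_ℂ ⊕ M̃_ℂ / W_p M̃_ℂ`. -/
theorem totF_eq_sup (k : ℤ) : (μ.totF k).baseChange R =
    (((μ.sub p).totF k).baseChange R).map (ext R (μ.totIncl p)) ⊔
      (((μ.quot p).totF k).baseChange R).map (ext R (μ.totSec p)) := by
  refine le_antisymm (fun z hz => ?_) (sup_le ?_ ?_)
  · rw [← totIncl_totRetr_add (p := p) z]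
    refine Submodule.add_mem_sup (Submodule.mem_map_of_mem ?_) (Submodule.mem_map_of_mem ?_)
    · have h := Submodule.mem_map_of_mem (f := ext R (μ.totRetr p)) hz
      rw [map_baseChange] at h
      exact baseChange_mono (μ.totF_map_retr p k) h
    · have h := Submodule.mem_map_of_mem (f := ext R (μ.totProj p)) hz
      rwa [map_baseChange, ← totF_quot] at h
  · rw [map_baseChange]
    exact baseChange_mono (μ.totF_sub_le p k)
  · rw [map_baseChange]
    exact baseChange_mono (totF_map_sec k)

/-- The Hodge filtration of a gluing: `γ (F) = α (F) + ψ (β (F))`. -/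
theorem IsGluing.map_totF {α : (μ.sub p).T R} {β : (μ.quot p).T R} {ψ : μ.Sec p R} {γ : μ.T R}
    (h : IsGluing α β ψ γ) (k : ℤ) : ((μ.totF k).baseChange R).map γ.toEquiv.toLinearMap =
      ((((μ.sub p).totF k).baseChange R).map α.toEquiv.toLinearMap).map (ext R (μ.W p).subtype) ⊔
      ((((μ.quot p).totF k).baseChange R).map β.toEquiv.toLinearMap).map ψ.toLin := by
  rw [totF_eq_sup μ p R, Submodule.map_sup, ← Submodule.map_comp, ← Submodule.map_comp,
    ← Submodule.map_comp, ← Submodule.map_comp]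
  have h1 : γ.toEquiv.toLinearMap ∘ₗ (ext R (μ.totIncl p) : Pts R (μ.sub p).Tot →ₗ[R] Pts R μ.Tot) =
      ext R (μ.W p).subtype ∘ₗ α.toEquiv.toLinearMap := LinearMap.ext h.apply_totIncl
  have h2 : γ.toEquiv.toLinearMap ∘ₗ (ext R (μ.totSec p) : Pts R (μ.quot p).Tot →ₗ[R] Pts R μ.Tot) =
      ψ.toLin ∘ₗ β.toEquiv.toLinearMap := LinearMap.ext h.apply_totSec
  rw [h1, h2]

theorem IsGluing.restrict_eq {α : (μ.sub p).T R} {β : (μ.quot p).T R} {ψ : μ.Sec p R} {γ : μ.T R}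
    (h : IsGluing α β ψ γ) : γ.restrict p = α :=
  (T.restrict_unique p γ α fun z => (h.apply_totIncl z).symm).symm

theorem IsGluing.descend_eq {α : (μ.sub p).T R} {β : (μ.quot p).T R} {ψ : μ.Sec p R} {γ : μ.T R}
    (h : IsGluing α β ψ γ) : γ.descend p = β := by
  refine (T.descend_unique p γ β fun z => ?_).symm
  conv_rhs => rw [← totIncl_totRetr_add (p := p) z, map_add, map_add, h.apply_totIncl,
    h.apply_totSec, WeightFiltration.ext_mkQ_subtype, zero_add, ψ.isSection]

/-- Every `γ ∈ T(μ)(R)` is the gluing of `γ_p` and `γ_{>p}` along a section. -/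
theorem exists_isGluing_restrict_descend (γ : μ.T R) :
    ∃ ψ : μ.Sec p R, IsGluing (γ.restrict p) (γ.descend p) ψ γ := by
  refine ⟨⟨γ.toEquiv.toLinearMap ∘ₗ
    (ext R (μ.totSec p) : Pts R (μ.quot p).Tot →ₗ[R] Pts R μ.Tot) ∘ₗ
      (γ.descend p).toEquiv.symm.toLinearMap, fun z => ?_⟩, fun z => ?_, fun z => ?_⟩
  · refine (γ.descend_spec p _).symm.trans ?_
    have h1 := ext_comp_apply (R := R) (μ.totProj p) (μ.totSec p)
      ((γ.descend p).toEquiv.symm z)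
    rw [μ.totProj_comp_totSec, ext_id_apply] at h1
    exact (congrArg _ h1.symm).trans ((γ.descend p).toEquiv.apply_symm_apply z)
  · exact (γ.restrict_spec p z).symm
  · change _ = γ.toEquiv (ext R (μ.totSec p) ((γ.descend p).toEquiv.symm ((γ.descend p).toEquiv z)))
    rw [LinearEquiv.symm_apply_apply]

theorem IsGluing.map {R' : Type w} [CommRing R'] [Algebra ℂ R'] (f : R →ₐ[ℂ] R')
    {α : (μ.sub p).T R} {β : (μ.quot p).T R} {ψ : μ.Sec p R} {γ : μ.T R}
    (h : IsGluing α β ψ γ) : IsGluing (α.map f) (β.map f) (ψ.map f) (γ.map f) := by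
  constructor
  · refine LinearMap.congr_fun (f := chgMap f γ.toEquiv.toLinearMap ∘ₗ
      (ext R' (μ.totIncl p) : Pts R' (μ.sub p).Tot →ₗ[R'] Pts R' μ.Tot))
      (g := ext R' (μ.W p).subtype ∘ₗ chgMap f α.toEquiv.toLinearMap) (hom_ext_chg f fun z => ?_)
    rw [LinearMap.comp_apply, LinearMap.comp_apply, chg_ext, chgMap_chg, chgMap_chg, chg_ext]
    exact congrArg _ (h.apply_totIncl z)
  · refine LinearMap.congr_fun (f := chgMap f γ.toEquiv.toLinearMap ∘ₗ
      (ext R' (μ.totSec p) : Pts R' (μ.quot p).Tot →ₗ[R'] Pts R' μ.Tot))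
      (g := chgMap f ψ.toLin ∘ₗ chgMap f β.toEquiv.toLinearMap) (hom_ext_chg f fun z => ?_)
    rw [LinearMap.comp_apply, LinearMap.comp_apply, chg_ext, chgMap_chg, chgMap_chg, chgMap_chg]
    exact congrArg _ (h.apply_totSec z)

/-- The filtration of the extension of scalars of `α` is obtained from `F_{[α]}`. -/
theorem map_totF_ofId {R : Type} [CommRing R] [Algebra ℂ R] (α : μ.T ℂ) (k : ℤ) :
    ((μ.totF k).baseChange R).map (α.map (Algebra.ofId ℂ R)).toEquiv.toLinearMap =
      (μ.hodgeF α.cls k).baseChange R := by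
  rw [T.map_toLinearMap, chgMap_ofId, map_baseChange, Submodule.map_comp, Submodule.map_comp,
    map_lid_symm]
  rfl

end Points

/-! ### The isomorphism between classes of sections and the fiber -/

section Fiber

variable {R : Type} [CommRing R] [Algebra ℂ R]

theorem map_totF_of_cls_eq {s : μ.SPts ℂ} {α : μ.T R}
    (h : α.cls = SPts.map (Algebra.ofId ℂ R) s) (k : ℤ) :
    ((μ.totF k).baseChange R).map α.toEquiv.toLinearMap = (μ.hodgeF s k).baseChange R := by
  induction s using Quotient.inductionOn with
  | _ α₀ => exact (T.cls_eq_iff.1 h k).trans (map_totF_ofId α₀ k)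

variable (x : (μ.sub p).SPts ℂ) (y : (μ.quot p).SPts ℂ)

/-- The filtration `F_x + ψ (F_y)` of `M_ℂ ⊗ R` defined by a section `ψ` over `R`. -/
noncomputable def secF (ψ : μ.Sec p R) (k : ℤ) : Submodule R (Pts R M) :=
  (((μ.sub p).hodgeF x k).baseChange R).map (ext R (μ.W p).subtype) ⊔
    (((μ.quot p).hodgeF y k).baseChange R).map ψ.toLin

variable {x y}

theorem IsGluing.map_totF_eq_secF {α : (μ.sub p).T R} {β : (μ.quot p).T R} {ψ : μ.Sec p R}
    {γ : μ.T R} (h : IsGluing α β ψ γ) (hα : α.cls = SPts.map (Algebra.ofId ℂ R) x)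
    (hβ : β.cls = SPts.map (Algebra.ofId ℂ R) y) (k : ℤ) :
    ((μ.totF k).baseChange R).map γ.toEquiv.toLinearMap = secF x y ψ k := by
  rw [h.map_totF, map_totF_of_cls_eq hα, map_totF_of_cls_eq hβ, secF]

/-- Two sections define the same filtration exactly when they differ by an element of
`F⁰_{x,y} Hom`. -/
theorem secF_eq_iff {ψ ψ' : μ.Sec p R} :
    (∀ k, secF x y ψ k = secF x y ψ' k) ↔ ψ.cls x y = ψ'.cls x y := by
  refine Iff.trans ?_ (Quotient.eq (r := μ.SecSetoid p x y R)).symm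
  constructor
  · intro h
    -- the difference of the sections is recovered from its image under a retraction `ρ`
    obtain ⟨ρ, s, hs, -⟩ := μ.exists_split p
    have hsub : ∀ z, ext R (μ.W p).subtype (ext R ρ (ψ'.toLin z - ψ.toLin z)) =
        ψ'.toLin z - ψ.toLin z := by
      intro z
      have h1 : ext R (μ.W p).mkQ (ψ'.toLin z - ψ.toLin z) = 0 := by
        rw [map_sub, ψ'.isSection, ψ.isSection, sub_self]
      conv_rhs => rw [← ext_id_apply (ψ'.toLin z - ψ.toLin z), ← hs,
        ext_add_apply, ext_comp_apply, ext_comp_apply, h1, map_zero, add_zero]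
    refine ⟨ext R ρ ∘ₗ (ψ'.toLin - ψ.toLin), fun k z hz => ?_, LinearMap.ext fun z => ?_⟩
    · have h1 : ψ'.toLin z ∈ secF x y ψ k := by
        rw [h k]
        exact Submodule.mem_sup_right (Submodule.mem_map_of_mem hz)
      -- write `ψ' z = a + ψ b` in `F_x + ψ (F_y)`; projecting to the quotient gives `b = z`
      obtain ⟨_, ⟨a, ha, rfl⟩, _, ⟨b, hb, rfl⟩, hab⟩ := Submodule.mem_sup.1 h1
      have h2 : b = z := by
        have := congrArg (ext R (μ.W p).mkQ) hab
        rwa [map_add, WeightFiltration.ext_mkQ_subtype, zero_add, ψ.isSection,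
          ψ'.isSection] at this
      rw [h2] at hab
      have h3 := hsub z
      rw [← hab, add_sub_cancel_right] at h3
      have h4 : ext R ρ (ψ'.toLin z - ψ.toLin z) = a := by
        refine ext_injective (R := R) _ (μ.W p).injective_subtype ?_
        rw [← hab, add_sub_cancel_right]
        exact h3
      rw [LinearMap.comp_apply, LinearMap.sub_apply, h4]
      exact ha
    · rw [LinearMap.add_apply, LinearMap.comp_apply, LinearMap.comp_apply, LinearMap.sub_apply,
        hsub, add_sub_cancel]
  · have key : ∀ (ψ ψ' : μ.Sec p R) (k : ℤ), μ.SecSetoid p x y R ψ ψ' →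
        secF x y ψ' k ≤ secF x y ψ k := by
      rintro ψ ψ' k ⟨f, hf, h⟩
      refine sup_le le_sup_left ?_
      rintro _ ⟨z, hz, rfl⟩
      rw [h, LinearMap.add_apply]
      exact Submodule.add_mem _ (Submodule.mem_sup_right (Submodule.mem_map_of_mem hz))
        (Submodule.mem_sup_left (Submodule.mem_map_of_mem (hf k z hz)))
    exact fun h k => le_antisymm (key _ _ k ((μ.SecSetoid p x y R).symm h)) (key _ _ k h)

variable (x y) in
/-- The class `[α + ψ β]`, for representatives `α` of `x` and `β` of `y`. -/
noncomputable def gluePt (ψ : μ.Sec p R) : μ.SPts R :=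
  (Classical.choose (exists_isGluing
    ((Quotient.out x : (μ.sub p).T ℂ).map (Algebra.ofId ℂ R))
    ((Quotient.out y : (μ.quot p).T ℂ).map (Algebra.ofId ℂ R)) ψ)).cls

theorem map_out_cls (s : μ.SPts ℂ) :
    ((Quotient.out s : μ.T ℂ).map (Algebra.ofId ℂ R)).cls = SPts.map (Algebra.ofId ℂ R) s :=
  congrArg (SPts.map (Algebra.ofId ℂ R)) (Quotient.out_eq s)

/-- `[α + ψ β]` does not depend on the representatives, not even on ones defined over `R`. -/
theorem IsGluing.gluePt_eq {α : (μ.sub p).T R} {β : (μ.quot p).T R} {ψ : μ.Sec p R}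
    {γ : μ.T R} (h : IsGluing α β ψ γ) (hα : α.cls = SPts.map (Algebra.ofId ℂ R) x)
    (hβ : β.cls = SPts.map (Algebra.ofId ℂ R) y) : gluePt x y ψ = γ.cls := by
  refine T.cls_eq_iff.2 fun k => ?_
  rw [h.map_totF_eq_secF hα hβ]
  exact (Classical.choose_spec (exists_isGluing
    ((Quotient.out x : (μ.sub p).T ℂ).map (Algebra.ofId ℂ R))
    ((Quotient.out y : (μ.quot p).T ℂ).map (Algebra.ofId ℂ R)) ψ)).map_totF_eq_secF
      (map_out_cls x) (map_out_cls y) k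

variable (x y) in
theorem exists_isGluing_gluePt (ψ : μ.Sec p R) : ∃ (α : (μ.sub p).T R) (β : (μ.quot p).T R)
    (γ : μ.T R), α.cls = SPts.map (Algebra.ofId ℂ R) x ∧ β.cls = SPts.map (Algebra.ofId ℂ R) y ∧
      IsGluing α β ψ γ ∧ gluePt x y ψ = γ.cls := by
  obtain ⟨γ, hγ⟩ := exists_isGluing ((Quotient.out x : (μ.sub p).T ℂ).map (Algebra.ofId ℂ R))
    ((Quotient.out y : (μ.quot p).T ℂ).map (Algebra.ofId ℂ R)) ψ
  exact ⟨_, _, γ, map_out_cls x, map_out_cls y, hγ, hγ.gluePt_eq (map_out_cls x) (map_out_cls y)⟩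

theorem gluePt_eq_iff {ψ ψ' : μ.Sec p R} :
    gluePt x y ψ = gluePt x y ψ' ↔ ψ.cls x y = ψ'.cls x y := by
  obtain ⟨α, β, γ, hα, hβ, hγ, h⟩ := exists_isGluing_gluePt x y ψ
  obtain ⟨α', β', γ', hα', hβ', hγ', h'⟩ := exists_isGluing_gluePt x y ψ'
  rw [h, h', T.cls_eq_iff, ← secF_eq_iff]
  exact forall_congr' fun k => by
    rw [hγ.map_totF_eq_secF hα hβ, hγ'.map_totF_eq_secF hα' hβ']

theorem gluePt_map {R' : Type} [CommRing R'] [Algebra ℂ R'] (f : R →ₐ[ℂ] R') (ψ : μ.Sec p R) :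
    gluePt x y (ψ.map f) = SPts.map f (gluePt x y ψ) := by
  have hf : f.comp (Algebra.ofId ℂ R) = Algebra.ofId ℂ R' := Subsingleton.elim _ _
  have hmap : ∀ {N : Type u} [AddCommGroup N] [Module ℚ N] {ν : Triple N} (s : ν.SPts ℂ),
      SPts.map f (SPts.map (Algebra.ofId ℂ R) s) = SPts.map (Algebra.ofId ℂ R') s := by
    intro N _ _ ν s
    rw [← hf]
    exact (ConcreteCategory.congr_hom (ν.S.map_comp
      (CommAlgCat.ofHom (Algebra.ofId ℂ R)) (CommAlgCat.ofHom f)) s).symm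
  obtain ⟨α, β, γ, hα, hβ, hγ, h⟩ := exists_isGluing_gluePt x y ψ
  rw [h, SPts.map_cls]
  refine (hγ.map f).gluePt_eq ?_ ?_
  · rw [← SPts.map_cls, hα, hmap]
  · rw [← SPts.map_cls, hβ, hmap]

variable (x y) in
theorem gluePt_mem_fiber (R : CommAlgCat.{0} ℂ) (ψ : μ.Sec p R) :
    gluePt x y ψ ∈ (μ.fiber p x y).obj R := by
  obtain ⟨α, β, γ, hα, hβ, hγ, h⟩ := exists_isGluing_gluePt x y ψ
  rw [h]
  refine Prod.ext ?_ ?_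
  · exact (congrArg T.cls hγ.restrict_eq).trans hα
  · exact (congrArg T.cls hγ.descend_eq).trans hβ

/-- The map from sections to the fiber is surjective: over `(x, y)`, the elements `γ_p` and `γ_{>p}`
are representatives of `x` and `y` over `R`. -/
theorem exists_gluePt_eq (R : CommAlgCat.{0} ℂ) {s : μ.SPts R}
    (hs : s ∈ (μ.fiber p x y).obj R) : ∃ ψ : μ.Sec p R, gluePt x y ψ = s := by
  induction s using Quotient.inductionOn with
  | _ γ =>
    obtain ⟨ψ, hψ⟩ := exists_isGluing_restrict_descend (p := p) γ
    exact ⟨ψ, hψ.gluePt_eq (congrArg Prod.fst hs) (congrArg Prod.snd hs)⟩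

variable (x y) in
/-- The bijection from classes of sections over `R` to the `R`-points of the fiber. -/
noncomputable def secEquivFiber (R : CommAlgCat.{0} ℂ) :
    μ.SecPts p x y R ≃ (μ.fiber p x y).obj R :=
  Equiv.ofBijective
    (Quotient.lift (fun ψ => ⟨gluePt x y ψ, gluePt_mem_fiber x y R ψ⟩) fun _ _ h =>
      Subtype.ext (gluePt_eq_iff.2 (Quotient.sound h)))
    ⟨fun a b => by
      induction a using Quotient.inductionOn with
      | _ ψ =>
        induction b using Quotient.inductionOn with
        | _ ψ' => exact fun h => gluePt_eq_iff.1 (congrArg Subtype.val h),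
    fun ⟨s, hs⟩ => by
      obtain ⟨ψ, hψ⟩ := exists_gluePt_eq R hs
      exact ⟨ψ.cls x y, Subtype.ext hψ⟩⟩

variable (μ p x y) in
/-- The isomorphism from the quotient of the scheme of sections to the fiber of `Θ_p`, which sends
the class of `ψ` to `[α + ψ β]`. -/
noncomputable def secIsoFiber : μ.SecQuot p x y ≅ (μ.fiber p x y).toFunctor :=
  NatIso.ofComponents (fun R => (secEquivFiber x y R).toIso) fun {R R'} f => by
    refine ConcreteCategory.hom_ext _ _ fun s => ?_
    induction s using Quotient.inductionOn with
    | _ ψ => exact Subtype.ext (gluePt_map f.hom ψ)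

end Fiber

/-! ### The mixed Hodge structure at a complex point -/

/-- The Hodge filtration at the image of a complex section `ψ` is `F_x + ψ (F_y)`. -/
theorem hodgeF_gluePt (x : (μ.sub p).SPts ℂ) (y : (μ.quot p).SPts ℂ)
    (ψ : (ℂ ⊗[ℚ] (M ⧸ μ.W p)) →ₗ[ℂ] (ℂ ⊗[ℚ] M))
    (hψ : ∀ v, (μ.W p).mkQ.baseChange ℂ (ψ v) = v) (k : ℤ) :
    μ.hodgeF (gluePt x y (Sec.ofComplex ℂ ψ hψ)) k =
      ((μ.sub p).hodgeF x k).map ((μ.W p).subtype.baseChange ℂ) ⊔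
        ((μ.quot p).hodgeF y k).map ψ := by
  obtain ⟨α, β, γ, hα, hβ, hγ, h⟩ := exists_isGluing_gluePt x y (Sec.ofComplex ℂ ψ hψ)
  rw [h]
  change (((μ.totF k).baseChange ℂ).map γ.toEquiv.toLinearMap).map
      (TensorProduct.lid ℂ (ℂ ⊗[ℚ] M)).toLinearMap = _
  rw [hγ.map_totF_eq_secF hα hβ, secF, Submodule.map_sup, map_baseChange_map_lid]
  congr 1
  exact map_baseChange_map_lid _ ψ

/-- The projection of `Gr^W M` to its component of degree `n`. -/
noncomputable def totProjGr (μ : Triple M) (n : ℤ) : μ.Tot →ₗ[ℚ] μ.Gr n :=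
  DirectSum.component ℚ ℤ (fun n => μ.Gr n) n

theorem totProjGr_ι (n : ℤ) (g : μ.Gr n) : μ.totProjGr n (μ.ι n g) = g :=
  DirectSum.component.lof_self ..

theorem totProjGr_ι_of_ne {m n : ℤ} (h : m ≠ n) (g : μ.Gr m) : μ.totProjGr n (μ.ι m g) = 0 :=
  (DirectSum.component.of ..).trans (dif_neg h)

theorem map_totProjGr_totF (n k : ℤ) :
    (μ.totF k).map ((μ.totProjGr n).baseChange ℂ) = (μ.hodge n).F k := by
  have h0 : ((μ.hodge n).F k).map ((μ.totProjGr n ∘ₗ μ.ι n).baseChange ℂ) = (μ.hodge n).F k := by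
    have h1 : μ.totProjGr n ∘ₗ μ.ι n = LinearMap.id := LinearMap.ext (totProjGr_ι n)
    rw [h1, LinearMap.baseChange_id, Submodule.map_id]
  rw [totF, Submodule.map_iSup]
  refine le_antisymm (iSup_le fun m => ?_) (le_iSup_of_le n ?_)
  · rw [← Submodule.map_comp, ← LinearMap.baseChange_comp]
    rcases eq_or_ne m n with rfl | h
    · exact h0.le
    · have h1 : μ.totProjGr n ∘ₗ μ.ι m = 0 := LinearMap.ext (totProjGr_ι_of_ne h)
      rw [h1, LinearMap.baseChange_zero, Submodule.map_zero]
      exact bot_le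
  · rw [← Submodule.map_comp, ← LinearMap.baseChange_comp]
    exact h0.ge

theorem map_ι_le_totF (n k : ℤ) : ((μ.hodge n).F k).map ((μ.ι n).baseChange ℂ) ≤ μ.totF k :=
  le_iSup (fun n => ((μ.hodge n).F k).map ((μ.ι n).baseChange ℂ)) n

theorem totProjGr_eq_zero {n : ℤ} {t : μ.Tot} (ht : t ∈ μ.totW (n - 1)) :
    μ.totProjGr n t = 0 := by
  have : μ.totW (n - 1) ≤ LinearMap.ker (μ.totProjGr n) := by
    refine iSup₂_le fun m hm => ?_
    rintro _ ⟨g, rfl⟩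
    exact totProjGr_ι_of_ne (by lia) g
  exact this ht

section

variable {R : Type w} [CommRing R] [Algebra ℂ R] (α : μ.T R)

/-- On `W_n`, the map `α` is compatible with the projections to the component of degree `n`. -/
theorem T.toGr_eq {n : ℤ} {t : Pts R μ.Tot} {u : Pts R (μ.W n)}
    (h : α.toEquiv t = ext R (μ.W n).subtype u) :
    ext R (μ.toGr n) u = ext R (μ.totProjGr n) t := by
  have ht : t ∈ extSub R (μ.totW n) := by
    refine (α.inducesGrId.mem_iff n t).1 ?_
    rw [extSub_eq_range]
    exact ⟨u, h.symm⟩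
  obtain ⟨u', t', ht', rfl⟩ := μ.exists_of_mem_totW ht
  have h1 := α.inducesGrId.gr_id n u'
  have h2 := α.inducesGrId.map_W _ _ ht'
  have h3 : ext R (μ.W n).subtype (u - u') ∈ extSub R (μ.W (n - 1)) := by
    rw [map_sub, ← h, map_add]
    have := Submodule.add_mem _ h1 h2
    convert this using 1
    exact (sub_add_eq_add_sub _ _ _).symm
  have h4 := μ.toGr_eq_zero_of_mem h3
  have h5 : ext R (μ.totProjGr n) t' = 0 := by
    have := ext_mem_extSub (Q := ⊥) (μ.totProjGr n) (fun m hm => totProjGr_eq_zero hm) ht'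
    rwa [extSub_bot] at this
  rw [map_sub, sub_eq_zero] at h4
  rw [map_add, h5, add_zero, h4, ← ext_comp_apply]
  congr 2
  exact LinearMap.ext fun m => (totProjGr_ι n _).symm

end

/-- The filtration `α (F)` induces the given Hodge filtrations on the graded pieces. -/
theorem inducedF_hodgeF (s : μ.SPts ℂ) (n k : ℤ) :
    μ.inducedF (μ.hodgeF s) n k = (μ.hodge n).F k := by
  induction s using Quotient.inductionOn with
  | _ α =>
  have hmem : ∀ v, v ∈ μ.hodgeF α.cls k ↔
      ∃ t ∈ (μ.totF k).baseChange ℂ, α.toEquiv t = 1 ⊗ₜ v := by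
    intro v
    rw [← one_tmul_mem_baseChange_iff, ← map_lid_symm]
    have h1 : (μ.hodgeF α.cls k).map (TensorProduct.lid ℂ (ℂ ⊗[ℚ] M)).symm.toLinearMap =
        ((μ.totF k).baseChange ℂ).map α.toEquiv.toLinearMap := by
      refine (Submodule.map_comp _ _ _).symm.trans ?_
      have h2 : (TensorProduct.lid ℂ (ℂ ⊗[ℚ] M)).symm.toLinearMap ∘ₗ
          (TensorProduct.lid ℂ (ℂ ⊗[ℚ] M)).toLinearMap = LinearMap.id :=
        LinearMap.ext fun z => (TensorProduct.lid ℂ _).symm_apply_apply z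
      rw [h2, Submodule.map_id]
    rw [h1]
    rfl
  refine le_antisymm ?_ fun g hg => ?_
  · rintro _ ⟨u, hu, rfl⟩
    obtain ⟨t, ht, htu⟩ := (hmem _).1 hu
    have h1 : α.toEquiv t = ext ℂ (μ.W n).subtype (1 ⊗ₜ u) := htu
    have h2 := α.toGr_eq h1
    refine one_tmul_mem_baseChange_iff.1 (?_ : ext ℂ (μ.toGr n) (1 ⊗ₜ u) ∈ _)
    rw [h2, ← map_totProjGr_totF n k, ← map_baseChange]
    exact Submodule.mem_map_of_mem ht
  · have ht : (1 : ℂ) ⊗ₜ[ℂ] (μ.ι n).baseChange ℂ g ∈ (μ.totF k).baseChange ℂ :=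
      Submodule.tmul_mem_baseChange_of_mem 1 (map_ι_le_totF n k (Submodule.mem_map_of_mem hg))
    have h1 : (1 : ℂ) ⊗ₜ[ℂ] (μ.ι n).baseChange ℂ g ∈ extSub ℂ (μ.totW n) :=
      ext_mem_extSub_of_range (R := ℂ) (μ.ι n) (fun m => μ.range_ι_le le_rfl ⟨m, rfl⟩) (1 ⊗ₜ g)
    have h2 := α.inducesGrId.map_W n _ h1
    rw [extSub_eq_range] at h2
    obtain ⟨u, hu⟩ := h2
    obtain ⟨u, rfl⟩ := (TensorProduct.lid ℂ (ℂ ⊗[ℚ] μ.W n)).symm.surjective u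
    rw [TensorProduct.lid_symm_apply] at hu
    refine ⟨u, (hmem _).2 ⟨_, ht, hu.symm⟩, ?_⟩
    have h3 := α.toGr_eq hu.symm
    have h4 : ext ℂ (μ.totProjGr n) ((1 : ℂ) ⊗ₜ[ℂ] (μ.ι n).baseChange ℂ g) = 1 ⊗ₜ g := by
      change (1 : ℂ) ⊗ₜ[ℂ] (μ.totProjGr n).baseChange ℂ ((μ.ι n).baseChange ℂ g) = _
      have h5 : μ.totProjGr n ∘ₗ μ.ι n = LinearMap.id := LinearMap.ext (totProjGr_ι n)
      rw [← LinearMap.comp_apply, ← LinearMap.baseChange_comp, h5, LinearMap.baseChange_id,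
        LinearMap.id_apply]
    rw [h4] at h3
    exact (TensorProduct.lid ℂ (ℂ ⊗[ℚ] μ.Gr n)).symm.injective h3

theorem totF_antitone : Antitone μ.totF := fun _ _ h =>
  iSup_mono fun n => Submodule.map_mono ((μ.hodge n).F_anti h)

/-- Only finitely many graded pieces of a triple are nonzero. -/
theorem exists_finset_subsingleton (μ : Triple M) :
    ∃ s : Finset ℤ, ∀ n ∉ s, Subsingleton (μ.Gr n) := by
  obtain ⟨b, hb⟩ := μ.exists_W_bot
  obtain ⟨t, ht⟩ := μ.exists_W_top
  refine ⟨Finset.Icc b t, fun n hn => Submodule.Quotient.subsingleton_iff.2 ?_⟩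
  rw [Finset.mem_Icc, not_and_or, not_le, not_le] at hn
  rw [Submodule.submoduleOf, Submodule.comap_subtype_eq_top]
  rcases hn with h | h
  · have : μ.W n = ⊥ := eq_bot_iff.2 (hb ▸ μ.W_mono h.le)
    rw [this]
    exact bot_le
  · have : μ.W (n - 1) = ⊤ := eq_top_iff.2 (ht ▸ μ.W_mono (show t ≤ n - 1 by lia))
    rw [this]
    exact le_top

theorem totF_eq_top_iff {k : ℤ} : μ.totF k = ⊤ ↔ ∀ n, (μ.hodge n).F k = ⊤ := by
  constructor
  · intro h n
    rw [← map_totProjGr_totF n k, h, Submodule.map_top, LinearMap.range_eq_top]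
    exact LinearMap.lTensor_surjective _ fun g => ⟨_, totProjGr_ι n g⟩
  · intro h
    refine eq_top_iff.2 fun z _ => ?_
    induction z with
    | zero => exact Submodule.zero_mem _
    | add a b ha hb => exact Submodule.add_mem _ (ha trivial) (hb trivial)
    | tmul a t =>
      induction t using WeightFiltration.tot_induction with
      | h0 => rw [TensorProduct.tmul_zero]; exact Submodule.zero_mem _
      | hadd t t' ht ht' =>
        rw [TensorProduct.tmul_add]
        exact Submodule.add_mem _ (ht trivial) (ht' trivial)
      | hι n g => exact map_ι_le_totF n k ⟨a ⊗ₜ g, by rw [h n]; trivial, rfl⟩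

theorem totF_eq_bot_iff {k : ℤ} : μ.totF k = ⊥ ↔ ∀ n, (μ.hodge n).F k = ⊥ := by
  constructor
  · intro h n
    rw [← map_totProjGr_totF n k, h, Submodule.map_bot]
  · intro h
    rw [totF, iSup_eq_bot]
    exact fun n => by rw [h n, Submodule.map_bot]

theorem exists_totF_eq_top (μ : Triple M) : ∃ k, μ.totF k = ⊤ := by
  obtain ⟨s, hs⟩ := μ.exists_finset_subsingleton
  choose κ hκ using fun n => (μ.hodge n).exists_F_top
  obtain ⟨k, hk⟩ := (s.image κ).exists_le (α := ℤᵒᵈ)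
  refine ⟨k, totF_eq_top_iff.2 fun n => ?_⟩
  by_cases hn : n ∈ s
  · exact eq_top_iff.2 (hκ n ▸ (μ.hodge n).F_anti (hk _ (Finset.mem_image_of_mem κ hn)))
  · have := hs n hn
    exact Subsingleton.elim _ _

theorem exists_totF_eq_bot (μ : Triple M) : ∃ k, μ.totF k = ⊥ := by
  obtain ⟨s, hs⟩ := μ.exists_finset_subsingleton
  choose κ hκ using fun n => (μ.hodge n).exists_F_bot
  obtain ⟨k, hk⟩ := (s.image κ).exists_le
  refine ⟨k, totF_eq_bot_iff.2 fun n => ?_⟩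
  by_cases hn : n ∈ s
  · exact eq_bot_iff.2 (hκ n ▸ (μ.hodge n).F_anti (hk _ (Finset.mem_image_of_mem κ hn)))
  · have := hs n hn
    exact Subsingleton.elim _ _

/-- The linear equivalence `M̃_ℂ ≃ M_ℂ` of a complex point of `T(μ)`, after identification of
`ℂ ⊗ V` with `V`. -/
noncomputable def T.complexEquiv (α : μ.T ℂ) : (ℂ ⊗[ℚ] μ.Tot) ≃ₗ[ℂ] (ℂ ⊗[ℚ] M) :=
  (TensorProduct.lid ℂ _).symm ≪≫ₗ α.toEquiv ≪≫ₗ TensorProduct.lid ℂ _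

theorem hodgeF_cls (α : μ.T ℂ) (k : ℤ) :
    μ.hodgeF α.cls k = (μ.totF k).map α.complexEquiv.toLinearMap := by
  change (((μ.totF k).baseChange ℂ).map α.toEquiv.toLinearMap).map
      (TensorProduct.lid ℂ (ℂ ⊗[ℚ] M)).toLinearMap = _
  rw [← map_lid_symm, ← Submodule.map_comp, ← Submodule.map_comp]
  rfl

theorem hodgeF_antitone (s : μ.SPts ℂ) : Antitone (μ.hodgeF s) := by
  induction s using Quotient.inductionOn with
  | _ α =>
    intro k l h
    exact (hodgeF_cls α l).trans_le
      ((Submodule.map_mono (totF_antitone h)).trans_eq (hodgeF_cls α k).symm)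

theorem hodgeF_eq_top_iff {s : μ.SPts ℂ} {k : ℤ} : μ.hodgeF s k = ⊤ ↔ μ.totF k = ⊤ := by
  induction s using Quotient.inductionOn with
  | _ α =>
    refine (Eq.congr_left (hodgeF_cls α k)).trans ?_
    exact map_eq_top_iff (Submodule.orderIsoMapComap α.complexEquiv)

theorem hodgeF_eq_bot_iff {s : μ.SPts ℂ} {k : ℤ} : μ.hodgeF s k = ⊥ ↔ μ.totF k = ⊥ := by
  induction s using Quotient.inductionOn with
  | _ α =>
    refine (Eq.congr_left (hodgeF_cls α k)).trans ?_
    exact map_eq_bot_iff (Submodule.orderIsoMapComap α.complexEquiv)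

variable (μ) in
/-- The mixed Hodge structure on `M` with Hodge filtration `F_s`, for a complex point `s` of
`S(μ)`. -/
noncomputable def mhs (s : μ.SPts ℂ) : MixedHodgeStructure M where
  toWeightFiltration := μ.toWeightFiltration
  F := μ.hodgeF s
  F_anti := hodgeF_antitone s
  exists_F_top := by
    obtain ⟨k, hk⟩ := μ.exists_totF_eq_top
    exact ⟨k, hodgeF_eq_top_iff.2 hk⟩
  exists_F_bot := by
    obtain ⟨k, hk⟩ := μ.exists_totF_eq_bot
    exact ⟨k, hodgeF_eq_bot_iff.2 hk⟩
  isCompl n k := by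
    rw [inducedF_hodgeF, inducedF_hodgeF]
    exact (μ.hodge n).isCompl k

theorem mhs_isAssociated (s : μ.SPts ℂ) : (μ.mhs s).IsAssociated μ :=
  Triple.ext rfl (heq_of_eq (funext fun n =>
    HodgeStructure.ext (funext fun k => inducedF_hodgeF s n k)))

end Triple

/-! ### The fiber is an affine space -/

theorem lid_rTensor_mem {R : Type w} [CommRing R] [Algebra ℂ R] {V : Type u} [AddCommGroup V]
    [Module ℂ V] (P : Submodule ℂ V) (l : R →ₗ[ℂ] ℂ) {z : R ⊗[ℂ] V} (hz : z ∈ P.baseChange R) :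
    TensorProduct.lid ℂ V (l.rTensor V z) ∈ P := by
  obtain ⟨t, rfl⟩ := hz
  induction t with
  | zero => simp
  | add a b ha hb => simpa only [map_add] using P.add_mem ha hb
  | tmul a v => simpa using P.smul_mem (l a) v.2

namespace Triple

variable {M : Type u} [AddCommGroup M] [Module ℚ M] {μ : Triple M} {p : ℤ}

section Affine

variable (x : (μ.sub p).SPts ℂ) (y : (μ.quot p).SPts ℂ)

/-- The complex vector space `F⁰_{x,y} Hom (M_ℂ / W_p M_ℂ, W_p M_ℂ)`. -/
def compatHom : Submodule ℂ ((ℂ ⊗[ℚ] (M ⧸ μ.W p)) →ₗ[ℂ] (ℂ ⊗[ℚ] μ.W p)) where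
  carrier := {f | ∀ k, ∀ v ∈ (μ.quot p).hodgeF y k, f v ∈ (μ.sub p).hodgeF x k}
  add_mem' hf hg k v hv := Submodule.add_mem _ (hf k v hv) (hg k v hv)
  zero_mem' _ _ _ := Submodule.zero_mem _
  smul_mem' c _ hf k v hv := Submodule.smul_mem _ c (hf k v hv)

variable {x y}

section Points

variable {R : Type w} [CommRing R] [Algebra ℂ R]

theorem baseChange_mem_F0Hom {f : (ℂ ⊗[ℚ] (M ⧸ μ.W p)) →ₗ[ℂ] (ℂ ⊗[ℚ] μ.W p)}
    (hf : f ∈ compatHom x y) : f.baseChange R ∈ μ.F0Hom p x y R := by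
  intro k z hz
  have h := Submodule.mem_map_of_mem (f := f.baseChange R) hz
  rw [map_baseChange] at h
  exact baseChange_mono (Submodule.map_le_iff_le_comap.2 (hf k)) h

variable {d : ℕ} (e : Fin d → (ℂ ⊗[ℚ] (M ⧸ μ.W p)) →ₗ[ℂ] (ℂ ⊗[ℚ] μ.W p))

/-- Linear functionals on `R` reduce membership in `F⁰_{x,y} Hom` over `R` to the same over `ℂ`. -/
theorem sum_mem_compatHom {r : Fin d → R}
    (h : ∑ j, r j • (e j).baseChange R ∈ μ.F0Hom p x y R) (l : R →ₗ[ℂ] ℂ) :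
    ∑ j, l (r j) • e j ∈ compatHom x y := by
  intro k v hv
  have h1 := lid_rTensor_mem _ l (h k (1 ⊗ₜ v) (Submodule.tmul_mem_baseChange_of_mem 1 hv))
  simpa [LinearMap.sum_apply, TensorProduct.smul_tmul'] using h1

theorem eq_zero_of_sum_mem_F0Hom
    (he : LinearIndependent ℂ fun j => (compatHom x y).mkQ (e j)) {r : Fin d → R}
    (h : ∑ j, r j • (e j).baseChange R ∈ μ.F0Hom p x y R) : r = 0 := by
  funext j
  refine (Module.forall_dual_apply_eq_zero_iff ℂ (r j)).1 fun l => ?_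
  refine Fintype.linearIndependent_iff.1 he (fun j => l (r j)) ?_ j
  have h1 : (compatHom x y).mkQ (∑ j, l (r j) • e j) = 0 :=
    (Submodule.Quotient.mk_eq_zero _).2 (sum_mem_compatHom e h l)
  simpa only [map_sum, map_smul] using h1

/-- Maps whose classes span `Hom / F⁰_{x,y} Hom` over `ℂ` do so over every `R`, as `Hom` commutes
with extension of scalars. -/
theorem exists_eq_sum_add_mem_F0Hom [FiniteDimensional ℚ M]
    (he : ⊤ ≤ Submodule.span ℂ (Set.range fun j => (compatHom x y).mkQ (e j)))
    (f : Pts R (M ⧸ μ.W p) →ₗ[R] Pts R (μ.W p)) :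
    ∃ r : Fin d → R, ∃ g ∈ μ.F0Hom p x y R, f = ∑ j, r j • (e j).baseChange R + g := by
  have := Module.finitePresentation_of_finite ℂ (ℂ ⊗[ℚ] (M ⧸ μ.W p))
  induction f using (Module.FinitePresentation.isBaseChange_map ℂ (ℂ ⊗[ℚ] (M ⧸ μ.W p))
    (ℂ ⊗[ℚ] μ.W p) R).inductionOn with
  | zero => exact ⟨0, 0, Submodule.zero_mem _, by simp⟩
  | tmul f =>
    obtain ⟨c, hc⟩ := (Submodule.mem_span_range_iff_exists_fun ℂ).1
      (he (show (compatHom x y).mkQ f ∈ ⊤ from trivial))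
    have h1 : f - ∑ j, c j • e j ∈ compatHom x y := by
      refine (Submodule.Quotient.mk_eq_zero _).1 ?_
      change (compatHom x y).mkQ _ = 0
      rw [map_sub, ← hc, map_sum, sub_eq_zero]
      simp only [map_smul]
    refine ⟨fun j => algebraMap ℂ R (c j), _, baseChange_mem_F0Hom h1, ?_⟩
    ext v
    simp [LinearMap.sum_apply, TensorProduct.tmul_sum]
  | smul a f hf =>
    obtain ⟨r, g, hg, rfl⟩ := hf
    refine ⟨a • r, a • g, Submodule.smul_mem _ a hg, ?_⟩
    simp only [smul_add, Finset.smul_sum, Pi.smul_apply, smul_assoc]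
  | add f f' hf hf' =>
    obtain ⟨r, g, hg, rfl⟩ := hf
    obtain ⟨r', g', hg', rfl⟩ := hf'
    refine ⟨r + r', g + g', Submodule.add_mem _ hg hg', ?_⟩
    simp only [Pi.add_apply, add_smul, Finset.sum_add_distrib]
    exact add_add_add_comm _ _ _ _

/-- The section `ψ₀ + ∑ r_j e_j` over `R`. -/
noncomputable def affineSec (ψ₀ : (ℂ ⊗[ℚ] (M ⧸ μ.W p)) →ₗ[ℂ] (ℂ ⊗[ℚ] M))
    (hψ₀ : ∀ v, (μ.W p).mkQ.baseChange ℂ (ψ₀ v) = v) (r : Fin d → R) : μ.Sec p R where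
  toLin := ψ₀.baseChange R + ext R (μ.W p).subtype ∘ₗ ∑ j, r j • (e j).baseChange R
  isSection z := by
    rw [LinearMap.add_apply, map_add, LinearMap.comp_apply, WeightFiltration.ext_mkQ_subtype,
      add_zero]
    exact (Sec.ofComplex R ψ₀ hψ₀).isSection z

variable (ψ₀ : (ℂ ⊗[ℚ] (M ⧸ μ.W p)) →ₗ[ℂ] (ℂ ⊗[ℚ] M))
  (hψ₀ : ∀ v, (μ.W p).mkQ.baseChange ℂ (ψ₀ v) = v)

theorem affineSec_cls_injective (he : LinearIndependent ℂ fun j => (compatHom x y).mkQ (e j)) :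
    Function.Injective fun r : Fin d → R => (affineSec e ψ₀ hψ₀ r).cls x y := by
  intro r s h
  obtain ⟨f, hf, hfs⟩ := Quotient.exact h
  have h1 : ∑ j, s j • (e j).baseChange R =
      ∑ j, (s - r) j • (e j).baseChange R + ∑ j, r j • (e j).baseChange R := by
    rw [← Finset.sum_add_distrib]
    refine Finset.sum_congr rfl fun j _ => ?_
    rw [← add_smul, Pi.sub_apply, sub_add_cancel]
  have h3 : f = ∑ j, (s - r) j • (e j).baseChange R := by
    refine LinearMap.ext fun z => ext_injective (R := R) _ (μ.W p).injective_subtype ?_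
    have h2 := LinearMap.congr_fun hfs z
    simp only [affineSec, LinearMap.add_apply, LinearMap.comp_apply, add_assoc,
      add_right_inj] at h2
    rw [h1, LinearMap.add_apply, map_add, add_comm] at h2
    exact (add_left_cancel h2).symm
  rw [h3] at hf
  exact (sub_eq_zero.1 (eq_zero_of_sum_mem_F0Hom e he hf)).symm

theorem affineSec_cls_surjective [FiniteDimensional ℚ M]
    (he : ⊤ ≤ Submodule.span ℂ (Set.range fun j => (compatHom x y).mkQ (e j))) :
    Function.Surjective fun r : Fin d → R => (affineSec e ψ₀ hψ₀ r).cls x y := by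
  intro s
  induction s using Quotient.inductionOn with
  | _ ψ =>
    have h1 : ∀ z, ∃ t, ext R (μ.W p).subtype t = ψ.toLin z - ψ₀.baseChange R z := fun z =>
      μ.exists_ext_subtype_eq p (by
        rw [map_sub, ψ.isSection, sub_eq_zero]
        exact ((Sec.ofComplex R ψ₀ hψ₀).isSection z).symm)
    obtain ⟨f, hf⟩ : ∃ f : Pts R (M ⧸ μ.W p) →ₗ[R] Pts R (μ.W p),
        ∀ z, ext R (μ.W p).subtype (f z) = ψ.toLin z - ψ₀.baseChange R z := by
      have hinj := ext_injective (R := R) _ (μ.W p).injective_subtype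
      choose f hf using h1
      refine ⟨⟨⟨f, fun z z' => hinj ?_⟩, fun c z => hinj ?_⟩, hf⟩
      · rw [map_add, hf, hf, hf, map_add, map_add, add_sub_add_comm]
      · rw [map_smul, hf, hf, map_smul, map_smul]
        exact (smul_sub _ _ _).symm
    obtain ⟨r, g, hg, rfl⟩ := exists_eq_sum_add_mem_F0Hom e he f
    refine ⟨r, Quotient.sound ⟨g, hg, LinearMap.ext fun z => ?_⟩⟩
    have h2 := hf z
    rw [LinearMap.add_apply, map_add] at h2
    simp only [affineSec, LinearMap.add_apply, LinearMap.comp_apply]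
    rw [add_assoc, h2, add_sub_cancel]

end Points

theorem affineSec_map {R R' : Type} [CommRing R] [Algebra ℂ R] [CommRing R'] [Algebra ℂ R']
    {d : ℕ} (e : Fin d → (ℂ ⊗[ℚ] (M ⧸ μ.W p)) →ₗ[ℂ] (ℂ ⊗[ℚ] μ.W p))
    (ψ₀ : (ℂ ⊗[ℚ] (M ⧸ μ.W p)) →ₗ[ℂ] (ℂ ⊗[ℚ] M))
    (hψ₀ : ∀ v, (μ.W p).mkQ.baseChange ℂ (ψ₀ v) = v) (f : R →ₐ[ℂ] R') (r : Fin d → R) :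
    (affineSec e ψ₀ hψ₀ r).map f = affineSec e ψ₀ hψ₀ fun j => f (r j) := by
  refine Sec.ext ?_
  change chgMap f (_ + _) = _ + _
  rw [chgMap_add, chgMap_comp, chgMap_baseChange, chgMap_baseChange]
  congr 2
  refine hom_ext_chg f fun z => ?_
  rw [chgMap_chg, LinearMap.sum_apply, LinearMap.sum_apply, map_sum]
  refine Finset.sum_congr rfl fun j _ => ?_
  rw [LinearMap.smul_apply, LinearMap.smul_apply, chg_smul, ← chgMap_baseChange f, chgMap_chg]

variable (x y) in
/-- The quotient of the scheme of sections is an affine space, of the dimension of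
`Hom / F⁰_{x,y} Hom`. -/
theorem isAffineSpace_secQuot [FiniteDimensional ℚ M] :
    IsAffineSpace (μ.SecQuot p x y) (Module.finrank ℂ
      (((ℂ ⊗[ℚ] (M ⧸ μ.W p)) →ₗ[ℂ] (ℂ ⊗[ℚ] μ.W p)) ⧸ compatHom x y)) := by
  let b := Module.finBasis ℂ
    (((ℂ ⊗[ℚ] (M ⧸ μ.W p)) →ₗ[ℂ] (ℂ ⊗[ℚ] μ.W p)) ⧸ compatHom x y)
  choose e he using fun j => (compatHom x y).mkQ_surjective (b j)
  have he' : (fun j => (compatHom x y).mkQ (e j)) = b := funext he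
  obtain ⟨ρ, s, -, hs⟩ := μ.exists_split p
  have hψ₀ : ∀ v, (μ.W p).mkQ.baseChange ℂ (s.baseChange ℂ v) = v := fun v => by
    rw [← LinearMap.comp_apply, ← LinearMap.baseChange_comp, hs, LinearMap.baseChange_id,
      LinearMap.id_apply]
  have hbij : ∀ R : CommAlgCat.{0} ℂ, Function.Bijective
      fun r : Fin _ → R => (affineSec e (s.baseChange ℂ) hψ₀ r).cls x y := fun R =>
    ⟨affineSec_cls_injective e _ hψ₀ (he' ▸ b.linearIndependent),
      affineSec_cls_surjective e _ hψ₀ (he' ▸ b.span_eq.ge)⟩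
  let c : ∀ R : CommAlgCat.{0} ℂ,
      (CommAlgCat.of ℂ (MvPolynomial (Fin (Module.finrank ℂ
        (((ℂ ⊗[ℚ] (M ⧸ μ.W p)) →ₗ[ℂ] (ℂ ⊗[ℚ] μ.W p)) ⧸ compatHom x y))) ℂ) ⟶ R) ≃
        (Fin (Module.finrank ℂ
          (((ℂ ⊗[ℚ] (M ⧸ μ.W p)) →ₗ[ℂ] (ℂ ⊗[ℚ] μ.W p)) ⧸ compatHom x y)) → R) := fun R =>
    { toFun := fun g j => g.hom (MvPolynomial.X j)
      invFun := fun r => CommAlgCat.ofHom (MvPolynomial.aeval r)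
      left_inv := fun g => CommAlgCat.hom_ext (MvPolynomial.algHom_ext fun j =>
        MvPolynomial.aeval_X _ j)
      right_inv := fun r => funext fun j => MvPolynomial.aeval_X r j }
  refine ⟨{ homEquiv := fun {R} => (c R).trans (Equiv.ofBijective _ (hbij R))
            homEquiv_comp := fun {R R'} g f => ?_ }⟩
  exact congrArg (Sec.cls x y) (affineSec_map e _ hψ₀ g.hom _).symm

end Affine

end Triple

/-! ### Positivity of the dimension -/

theorem conj_conj {H : Type u} [AddCommGroup H] [Module ℚ H] (z : ℂ ⊗[ℚ] H) :
    conj H (conj H z) = z := by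
  induction z with
  | zero => simp
  | add a b ha hb => rw [map_add, map_add, ha, hb]
  | tmul a h => simp [conj]

theorem comap_conj_comap_conj {H : Type u} [AddCommGroup H] [Module ℚ H]
    (P : Submodule ℂ (ℂ ⊗[ℚ] H)) : (P.comap (conj H)).comap (conj H) = P := by
  ext z
  rw [Submodule.mem_comap, Submodule.mem_comap, conj_conj]

theorem HodgeStructure.F_eq_top_of_eq_bot {n : ℤ} {H : Type u} [AddCommGroup H]
    [Module ℚ H] (h : HodgeStructure n H) {k : ℤ} (hk : h.F k = ⊥) : h.F (n + 1 - k) = ⊤ := by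
  have h1 := h.isCompl k
  rw [hk] at h1
  rw [← comap_conj_comap_conj (h.F (n + 1 - k)), eq_top_of_bot_isCompl h1, Submodule.comap_top]

theorem HodgeStructure.F_eq_bot_of_eq_top {n : ℤ} {H : Type u} [AddCommGroup H]
    [Module ℚ H] (h : HodgeStructure n H) {k : ℤ} (hk : h.F k = ⊤) : h.F (n + 1 - k) = ⊥ := by
  have h1 := h.isCompl k
  rw [hk] at h1
  refine (Submodule.eq_bot_iff _).2 fun z hz => ?_
  have h2 : conj H z ∈ (h.F (n + 1 - k)).comap (conj H) := by
    rwa [Submodule.mem_comap, conj_conj]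
  rw [eq_bot_of_top_isCompl h1] at h2
  rw [← conj_conj z, (Submodule.mem_bot ℂ).1 h2, map_zero]

namespace Triple

variable {M : Type u} [AddCommGroup M] [Module ℚ M] {μ : Triple M} {p : ℤ}

theorem exists_nontrivial_gr (μ : Triple M) [Nontrivial M] : ∃ n, Nontrivial (μ.Gr n) := by
  by_contra! h
  obtain ⟨b, hb⟩ := μ.exists_W_bot
  obtain ⟨t, ht⟩ := μ.exists_W_top
  have key : ∀ n, b ≤ n → μ.W n = ⊥ := by
    intro n hn
    induction n, hn using Int.leInduction with
    | base => exact hb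
    | succ n hn ih =>
      have h1 : (μ.W (n + 1 - 1)).submoduleOf (μ.W (n + 1)) = ⊤ :=
        Submodule.Quotient.subsingleton_iff.1 (h (n + 1))
      rw [add_sub_cancel_right, Submodule.submoduleOf, Submodule.comap_subtype_eq_top, ih] at h1
      exact eq_bot_iff.2 h1
  have h1 : (⊤ : Submodule ℚ M) ≤ ⊥ := by
    rw [← key (max b t) (le_max_left _ _), ← ht]
    exact μ.W_mono (le_max_right _ _)
  exact bot_ne_top (top_le_iff.1 (h1.trans le_rfl))

theorem bot_ne_top_complexification {H : Type u} [AddCommGroup H] [Module ℚ H] [Nontrivial H] :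
    (⊥ : Submodule ℂ (ℂ ⊗[ℚ] H)) ≠ ⊤ := by
  have : Nontrivial (ℂ ⊗[ℚ] H) := inferInstance
  exact bot_ne_top

/-- As the weights of `W_p M` are smaller than those of `M / W_p M`, not every linear map
`M_ℂ / W_p M_ℂ → W_p M_ℂ` is compatible with the Hodge filtrations. -/
theorem compatHom_ne_top (x : (μ.sub p).SPts ℂ) (y : (μ.quot p).SPts ℂ) [Nontrivial (μ.W p)]
    [Nontrivial (M ⧸ μ.W p)] : compatHom x y ≠ ⊤ := by
  intro htop
  obtain ⟨m, hm⟩ := (μ.sub p).exists_nontrivial_gr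
  obtain ⟨n, hn⟩ := (μ.quot p).exists_nontrivial_gr
  have hmp : m ≤ p := by
    by_contra! h
    exact not_subsingleton_iff_nontrivial.2 hm (μ.subsingleton_gr_sub h)
  have hnp : p < n := by
    by_contra! h
    exact not_subsingleton_iff_nontrivial.2 hn (μ.subsingleton_gr_quot h)
  obtain ⟨k, hk, hk'⟩ : ∃ k, (μ.quot p).totF k ≠ ⊥ ∧ (μ.quot p).totF (k + 1) = ⊥ := by
    obtain ⟨a, ha⟩ := (μ.quot p).exists_totF_eq_top
    obtain ⟨b, hb⟩ := (μ.quot p).exists_totF_eq_bot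
    obtain ⟨k, hk, hmax⟩ := Int.exists_greatest_of_bdd (P := fun k => (μ.quot p).totF k ≠ ⊥)
      ⟨b, fun z hz => by
        by_contra! h
        exact hz (eq_bot_iff.2 (hb ▸ totF_antitone h.le))⟩
      ⟨a, fun h => bot_ne_top_complexification (H := (μ.quot p).Gr n) (by
        rw [← totF_eq_bot_iff.1 h n, totF_eq_top_iff.1 ha n])⟩
    refine ⟨k, hk, ?_⟩
    by_contra! h
    exact absurd (hmax _ h) (by lia)
  have hx : (μ.sub p).totF k = ⊤ := by
    -- a nonzero vector of `F_y^k` is sent to any given vector by some linear map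
    have hyk : (μ.quot p).hodgeF y k ≠ ⊥ := mt hodgeF_eq_bot_iff.1 hk
    obtain ⟨v, hv, hv0⟩ := (Submodule.ne_bot_iff _).1 hyk
    obtain ⟨l, hl⟩ : ∃ l : Module.Dual ℂ (ℂ ⊗[ℚ] (M ⧸ μ.W p)), l v ≠ 0 := by
      by_contra! h
      exact hv0 ((Module.forall_dual_apply_eq_zero_iff ℂ v).1 h)
    refine (hodgeF_eq_top_iff (s := x)).1 (eq_top_iff.2 fun w _ => ?_)
    have h1 : l.smulRight ((l v)⁻¹ • w) ∈ compatHom x y := by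
      rw [htop]
      trivial
    have h2 := h1 k v hv
    rwa [LinearMap.smulRight_apply, smul_inv_smul₀ hl] at h2
  have h1 := ((μ.quot p).hodge n).F_eq_top_of_eq_bot (totF_eq_bot_iff.1 hk' n)
  have h2 := ((μ.sub p).hodge m).F_eq_bot_of_eq_top (totF_eq_top_iff.1 hx m)
  -- Hodge symmetry in the weight `n` of `M / W_p M` gives `n ≤ 2 k`
  have h3 : n + 1 - (k + 1) < k + 1 := by
    by_contra! h
    refine bot_ne_top_complexification (H := (μ.quot p).Gr n) (le_bot_iff.1 ?_).symm
    rw [← h1, ← totF_eq_bot_iff.1 hk' n]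
    exact ((μ.quot p).hodge n).F_anti h
  -- Hodge symmetry in the weight `m` of `W_p M` gives `2 k ≤ m`
  have h4 : k < m + 1 - k := by
    by_contra! h
    refine bot_ne_top_complexification (H := (μ.sub p).Gr m) (le_bot_iff.1 ?_).symm
    rw [← totF_eq_top_iff.1 hx m, ← h2]
    exact ((μ.sub p).hodge m).F_anti h
  lia

end Triple
end MHS

theorem proposition2p3 {M : Type u} [AddCommGroup M] [Module ℚ M] [FiniteDimensional ℚ M]
    (μ : MHS.Triple M) (p : ℤ) (x : (μ.sub p).SPts ℂ) (y : (μ.quot p).SPts ℂ) :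
    (∃ Φ : μ.SecQuot p x y ≅ (μ.fiber p x y).toFunctor,
      -- the isomorphism is canonical: it sends the class of `ψ` to the class of `α + ψ β`
      -- for all representatives `α` of `x` and `β` of `y`
      (∀ (α : (μ.sub p).T ℂ) (β : (μ.quot p).T ℂ), α.cls = x → β.cls = y →
        ∀ (R : CommAlgCat.{0} ℂ) (ψ : μ.Sec p R), ∃ γ : μ.T R,
          MHS.Triple.IsGluing (α.map (Algebra.ofId ℂ R)) (β.map (Algebra.ofId ℂ R)) ψ γ ∧
          (Φ.hom.app R (ψ.cls x y)).1 = γ.cls) ∧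
      -- the Hodge filtration at the image of a section
      (∀ (ψ : (ℂ ⊗[ℚ] (M ⧸ μ.W p)) →ₗ[ℂ] (ℂ ⊗[ℚ] M))
        (hψ : ∀ v, (μ.W p).mkQ.baseChange ℂ (ψ v) = v),
        ∃ N : MHS.MixedHodgeStructure M, N.IsAssociated μ ∧
          N.F = μ.hodgeF (Φ.hom.app (CommAlgCat.of ℂ ℂ)
            ((MHS.Triple.Sec.ofComplex ℂ ψ hψ).cls x y)).1 ∧
          ∀ k, N.F k = ((μ.sub p).hodgeF x k).map ((μ.W p).subtype.baseChange ℂ) ⊔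
            ((μ.quot p).hodgeF y k).map ψ)) ∧
    -- the fiber is an affine space
    ∃ d : ℕ, MHS.IsAffineSpace (μ.fiber p x y).toFunctor d ∧
      (Nontrivial (μ.W p) → Nontrivial (M ⧸ μ.W p) → 1 ≤ d) := by
  refine ⟨⟨MHS.Triple.secIsoFiber μ p x y, fun α β hα hβ R ψ => ?_, fun ψ hψ => ?_⟩,
    _, (MHS.Triple.isAffineSpace_secQuot x y).map fun c =>
      c.ofIso (MHS.Triple.secIsoFiber μ p x y), fun _ _ => ?_⟩
  · obtain ⟨γ, hγ⟩ :=
      MHS.Triple.exists_isGluing (α.map (Algebra.ofId ℂ R)) (β.map (Algebra.ofId ℂ R)) ψ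
    exact ⟨γ, hγ, hγ.gluePt_eq (congrArg (MHS.Triple.SPts.map _) hα)
      (congrArg (MHS.Triple.SPts.map _) hβ)⟩
  · exact ⟨μ.mhs (MHS.Triple.gluePt x y (MHS.Triple.Sec.ofComplex ℂ ψ hψ)),
      MHS.Triple.mhs_isAssociated _, rfl, MHS.Triple.hodgeF_gluePt x y ψ hψ⟩
  · have := Submodule.Quotient.nontrivial_iff.2 (MHS.Triple.compatHom_ne_top x y)
    exact Nat.one_le_iff_ne_zero.2 Module.finrank_pos.ne'
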